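/- Let $\mu,\nu$ be Borel probability measures on $\mathbb R^d$. Assume that $\nu$ is finitely supported, with support consisting of the distinct points $y_1,\dots,y_n$, and that $\mu$ has finite second moment and a density $p\ge 0$ with respect to Lebesgue measure, such that the interior of $\operatorname{supp}\mu$ is connected, the boundary of $\operatorname{supp}\mu$ is Lebesgue-null, and $p>0$ on the interior of $\operatorname{supp}\mu$. Let $(f^*,g^*)$ maximize $\mathbb E_\mu f+\mathbb E_\nu g$ over all $(f,g)\in L^1(\mu)\times L^1(\nu)$ with $f(x)+g(y_i)\le\|x-y_i\|^2$ for $\mu$-a.e. $x$ and all $i$, normalized by $\mathbb E_\nu g^*=0$. For $\eta>0$ let $(f_\eta,g_\eta)$ maximize $$\mathbb E_\mu f+\mathbb E_\nu g-\frac1\eta\sum_{j=1}^n\int e^{-\eta(\|x-y_j\|^2-f(x)-g(y_j))}\,d\mu(x)+\frac1\eta$$ over all $(f,g)\in L^1(\mu)\times L^1(\nu)$, normalized by $\mathbb E_\nu g_\eta=0$. For $i\ne j$ and $a,t\ge0$ let $S_{ij}(a)$ be the set of all $x$ with $\|x-y_i\|^2-g^*(y_i)\le\|x-y_k\|^2-g^*(y_k)-a\mathbf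 1_{k\ne i,j}$ for all $k$, let $\Delta_{ij}(x)=(\|x-y_j\|^2-g^*(y_j))-(\|x-y_i\|^2-g^*(y_i))$, and let $h_{ij}(t;a)=\int_{\{x\in S_{ij}(a):\,\Delta_{ij}(x)=t\}}p\,d\mathcal H^{d-1}\in[0,\infty]$. Assume that at least one of the following holds: (a) for all $i\ne j$, $h_{ij}(0;0)<\infty$, the function $t\mapsto h_{ij}(t;a)$ on $[0,\infty)$ is continuous at $0$ for all sufficiently small $a\ge0$, and the function $a\mapsto h_{ij}(0;a)$ on $[0,\infty)$ is continuous at $0$; (b) $\mu$ is compactly supported and $p$ is continuous on $\mathbb R^d$. Then, as $\eta\to\infty$, $\eta(g_\eta-g^*)\to0$ uniformly on $\operatorname{supp}\nu$, that is, $\max_i|\eta(g_\eta(y_i)-g^*(y_i))|\to0$. Moreover, each $f_\eta$ agrees $\mu$-a.e. with a continuous function $\tilde f_\eta$ on $\mathbb R^d$, and these can be chosen such that for $\mu$-a.e. $x$ one has $\eta(\tilde f_\eta(x)-f^*(x))\to0$ as $\eta\to\infty$. In this sense the potentials converge at rate $o(\eta^{-1})$. -/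

import Mathlib

open MeasureTheory Filter Topology Set
open scoped ENNReal NNReal

noncomputable section

namespace SemiDiscreteOT

variable {d n : ℕ}

/-- `ν` is finitely supported, with support exactly the `n` distinct points `y i`. -/
structure IsFinitelySupportedOn (ν : Measure (EuclideanSpace ℝ (Fin d)))
    (y : Fin n → EuclideanSpace ℝ (Fin d)) : Prop where
  injective : Function.Injective y
  pos : ∀ i, 0 < ν {y i}
  compl_null : ν (Set.range y)ᶜ = 0

/-- `μ` has Lebesgue density `p` and finite second moment; the interior of its support is
connected, the boundary of its support is Lebesgue-null, and the density is positive on the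
interior of the support. -/
structure IsRegularSource (μ : Measure (EuclideanSpace ℝ (Fin d)))
    (p : EuclideanSpace ℝ (Fin d) → ℝ≥0) : Prop where
  measurable_density : Measurable p
  eq_withDensity : μ = volume.withDensity (fun x => (p x : ℝ≥0∞))
  second_moment : Integrable (fun x => ‖x‖ ^ 2) μ
  connected : IsConnected (interior μ.support)
  frontier_null : volume (frontier μ.support) = 0
  density_pos : ∀ x ∈ interior μ.support, 0 < p x

/-! ### The unregularized dual problem -/

/-- The pair `(f, g) ∈ L¹(μ) × L¹(ν)` satisfies `f(x) + g(z) ≤ ‖x - z‖²` for `μ`-almost every `x`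
and every `z` in the support `{y i}` of `ν`. -/
structure IsDualFeasible (μ ν : Measure (EuclideanSpace ℝ (Fin d)))
    (y : Fin n → EuclideanSpace ℝ (Fin d)) (f g : EuclideanSpace ℝ (Fin d) → ℝ) : Prop where
  integrable_left : Integrable f μ
  integrable_right : Integrable g ν
  le_cost : ∀ᵐ x ∂μ, ∀ i, f x + g (y i) ≤ ‖x - y i‖ ^ 2

/-- `(f, g)` maximizes `E_μ[f] + E_ν[g]` among all feasible pairs, and `E_ν[g] = 0`. -/
structure IsOptimalPotentials (μ ν : Measure (EuclideanSpace ℝ (Fin d)))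
    (y : Fin n → EuclideanSpace ℝ (Fin d)) (f g : EuclideanSpace ℝ (Fin d) → ℝ) : Prop where
  feasible : IsDualFeasible μ ν y f g
  optimal : ∀ f' g' : EuclideanSpace ℝ (Fin d) → ℝ, IsDualFeasible μ ν y f' g' →
    ∫ x, f' x ∂μ + ∫ z, g' z ∂ν ≤ ∫ x, f x ∂μ + ∫ z, g z ∂ν
  normalized : ∫ z, g z ∂ν = 0

/-! ### The entropic dual problem -/

/-- The entropic dual objective
`E_μ[f] + E_ν[g] - η⁻¹ ∑ⱼ ∫ exp (-η (‖x - yⱼ‖² - f(x) - g(yⱼ))) dμ(x) + η⁻¹`, with values in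
the extended reals: it is `-∞` where the exponential is not integrable. -/
def entropicDual (μ ν : Measure (EuclideanSpace ℝ (Fin d)))
    (y : Fin n → EuclideanSpace ℝ (Fin d)) (η : ℝ) (f g : EuclideanSpace ℝ (Fin d) → ℝ) : EReal :=
  ((∫ x, f x ∂μ + ∫ z, g z ∂ν + 1 / η : ℝ) : EReal) -
    ((ENNReal.ofReal (1 / η) *
      ∑ j, ∫⁻ x, ENNReal.ofReal (Real.exp (-η * (‖x - y j‖ ^ 2 - f x - g (y j)))) ∂μ : ℝ≥0∞) :
        EReal)

/-- `(f, g) ∈ L¹(μ) × L¹(ν)` maximizes the entropic dual objective over `L¹(μ) × L¹(ν)`, and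
`E_ν[g] = 0`. -/
structure IsEntropicPotentials (μ ν : Measure (EuclideanSpace ℝ (Fin d)))
    (y : Fin n → EuclideanSpace ℝ (Fin d)) (η : ℝ)
    (f g : EuclideanSpace ℝ (Fin d) → ℝ) : Prop where
  integrable_left : Integrable f μ
  integrable_right : Integrable g ν
  optimal : ∀ f' g' : EuclideanSpace ℝ (Fin d) → ℝ, Integrable f' μ → Integrable g' ν →
    entropicDual μ ν y η f' g' ≤ entropicDual μ ν y η f g
  normalized : ∫ z, g z ∂ν = 0

/-! ### Power cells, slacks and regularity along hyperplanes -/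

/-- The slack `Δᵢⱼ(x) = (‖x - yⱼ‖² - g(yⱼ)) - (‖x - yᵢ‖² - g(yᵢ))`. On the `i`-th power cell the
optimal first potential is `‖x - yᵢ‖² - g(yᵢ)`, so this is `‖x - yⱼ‖² - f(x) - g(yⱼ)` there. -/
def slack (y : Fin n → EuclideanSpace ℝ (Fin d)) (g : EuclideanSpace ℝ (Fin d) → ℝ)
    (i j : Fin n) (x : EuclideanSpace ℝ (Fin d)) : ℝ :=
  (‖x - y j‖ ^ 2 - g (y j)) - (‖x - y i‖ ^ 2 - g (y i))

/-- `Sᵢⱼ(a)`: the points `x` with `‖x - yᵢ‖² - g(yᵢ) ≤ ‖x - yₖ‖² - g(yₖ) - a 𝟙[k ≠ i, j]` for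
all `k`. For `a = 0` this is the `i`-th power cell. -/
def cell (y : Fin n → EuclideanSpace ℝ (Fin d)) (g : EuclideanSpace ℝ (Fin d) → ℝ)
    (i j : Fin n) (a : ℝ) : Set (EuclideanSpace ℝ (Fin d)) :=
  {x | ∀ k, ‖x - y i‖ ^ 2 - g (y i) ≤
    ‖x - y k‖ ^ 2 - g (y k) - (if k ≠ i ∧ k ≠ j then a else 0)}

/-- `Hᵢⱼ(t; a)`: the part of `Sᵢⱼ(a)` in the hyperplane `Δᵢⱼ = t`. -/
def slice (y : Fin n → EuclideanSpace ℝ (Fin d)) (g : EuclideanSpace ℝ (Fin d) → ℝ)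
    (i j : Fin n) (t a : ℝ) : Set (EuclideanSpace ℝ (Fin d)) :=
  {x | x ∈ cell y g i j a ∧ slack y g i j x = t}

/-- `hᵢⱼ(t; a)`: the integral of the density `p` over `Hᵢⱼ(t; a)` with respect to the
`(d - 1)`-dimensional Hausdorff measure (Mathlib's normalization of that measure differs from the
usual one by a positive constant, which plays no role for finiteness and continuity). -/
def sliceMass (p : EuclideanSpace ℝ (Fin d) → ℝ≥0)
    (y : Fin n → EuclideanSpace ℝ (Fin d)) (g : EuclideanSpace ℝ (Fin d) → ℝ)
    (i j : Fin n) (t a : ℝ) : ℝ≥0∞ :=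
  ∫⁻ x in slice y g i j t a, (p x : ℝ≥0∞) ∂(Measure.hausdorffMeasure ((d : ℝ) - 1))

/-- For all `i ≠ j`, the functions `t ↦ hᵢⱼ(t; a)` (for all sufficiently small `a ≥ 0`) and
`a ↦ hᵢⱼ(0; a)`, defined for nonnegative arguments, are finite and continuous at `0`. (Finiteness
of all `hᵢⱼ(0; a)`, `a ≥ 0`, is that of `hᵢⱼ(0; 0)`.) -/
structure IsContinuousAlongHyperplanes (p : EuclideanSpace ℝ (Fin d) → ℝ≥0)
    (y : Fin n → EuclideanSpace ℝ (Fin d)) (g : EuclideanSpace ℝ (Fin d) → ℝ) : Prop where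
  finite : ∀ i j, i ≠ j → sliceMass p y g i j 0 0 ≠ ∞
  continuous_slice : ∀ i j, i ≠ j → ∀ᶠ a in 𝓝[≥] (0 : ℝ),
    ContinuousWithinAt (fun t => sliceMass p y g i j t a) (Set.Ici 0) 0
  continuous_push : ∀ i j, i ≠ j →
    ContinuousWithinAt (fun a => sliceMass p y g i j 0 a) (Set.Ici 0) 0

end SemiDiscreteOT

end

/-! For fixed `g` the best `f` is explicit: `softMin`, the entropic transform of the weights `g ∘
y`, in the regularized problem (`IsEntropicPotentials.ae_eq_softMin`) and `powerMin` in the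
unregularized one. Both problems thus become concave problems in finitely many weights. Optimality
of `g*` says that its power cells have the masses of the points `y i`
(`IsOptimalPotentials.measure_powerCell`).

Write the weights as `g* + v / η` with `v` of mean zero and expand the semi-dual functional on each
power cell. The zeroth-order term is `v i`, and it integrates to zero because of the cell masses.
The next term splits, up to products of two exponentials (`le_log_sum_mul_exp_sub`), into one
contribution `profile (v k - v i) (η Δᵢₖ)` per neighbour. The law of `Δᵢₖ` on the cell has a density
continuous at `0`, proportional to `hᵢₖ`. Laplace's method (`tendsto_mul_integral_comp_mul`)
therefore turns `η` times this contribution into `r i k * Φ (v k - v i)` with `Φ u = ∫₀^∞ profile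
u`, while the products vanish in the limit (`tendsto_integral_powerCell_triple`).

Since `g_η` is at least as good as `g*`, a limit `w` of such `v` satisfies `∑ r i k * Φ (w k - w i)
≤ 0`. The coefficients are symmetric and `Φ u + Φ (-u) > 0` for `u ≠ 0`, so `w` agrees across every
interface of positive mass. Connectedness of the interior of the support links all cells by such
interfaces (`exists_sliceMass_ne_zero`), so `w` is constant, hence zero by normalization.
Boundedness of `η (g_η - g*)` need not be known beforehand: by concavity the weights can be shrunk
towards `g*` into the unit ball (`tendsto_weights`). Convergence of `f_η` then follows from the
explicit formulas away from the null interfaces.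

A compactly supported continuous density satisfies the hyperplane condition by dominated convergence
(`IsContinuousAlongHyperplanes.of_continuous`). -/

noncomputable section

namespace SemiDiscreteOT

/-! ### Integration along parallel hyperplanes -/

section Coarea

variable {E : Type*} [NormedAddCommGroup E] [InnerProductSpace ℝ E]

/-- The isometric parametrization of the hyperplane `⟪v, x⟫ = t` by the orthogonal complement
of `v`. -/
def hyperplaneMap (v : E) (t : ℝ) (z : (ℝ ∙ v)ᗮ) : E := (z : E) + (t * (‖v‖ ^ 2)⁻¹) • v

lemma isometry_hyperplaneMap (v : E) (t : ℝ) : Isometry (hyperplaneMap v t) :=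
  Isometry.of_dist_eq fun a b => by
    simp only [hyperplaneMap, dist_add_right]; rfl

lemma inner_hyperplaneMap {v : E} (hv : v ≠ 0) (t : ℝ) (z : (ℝ ∙ v)ᗮ) :
    inner ℝ v (hyperplaneMap v t z) = t := by
  have h : inner ℝ v (z : E) = 0 := Submodule.mem_orthogonal_singleton_iff_inner_right.1 z.2
  have : ‖v‖ ≠ 0 := by simpa using hv
  rw [hyperplaneMap, inner_add_right, h, inner_smul_right, real_inner_self_eq_norm_sq]
  field_simp
  ring

lemma range_hyperplaneMap {v : E} (hv : v ≠ 0) (t : ℝ) :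
    range (hyperplaneMap v t) = {x | inner ℝ v x = t} := by
  ext x
  refine ⟨?_, fun hx => ?_⟩
  · rintro ⟨z, rfl⟩
    exact inner_hyperplaneMap hv t z
  · have : ‖v‖ ≠ 0 := by simpa using hv
    refine ⟨⟨x - (t * (‖v‖ ^ 2)⁻¹) • v, ?_⟩, by simp [hyperplaneMap]⟩
    rw [Submodule.mem_orthogonal_singleton_iff_inner_right, inner_sub_right, inner_smul_right,
      real_inner_self_eq_norm_sq, hx]
    field_simp
    ring

lemma continuous_hyperplaneMap (v : E) :
    Continuous fun q : ℝ × (ℝ ∙ v)ᗮ => hyperplaneMap v q.1 q.2 := by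
  unfold hyperplaneMap
  fun_prop

variable [FiniteDimensional ℝ E]

/-- The decomposition of a vector along `v` and its orthogonal complement. -/
lemma exists_hyperplaneEquiv {v : E} (hv : v ≠ 0) :
    ∃ e : (ℝ × (ℝ ∙ v)ᗮ) ≃L[ℝ] E, ∀ q, e q = hyperplaneMap v q.1 q.2 := by
  let L : (ℝ × (ℝ ∙ v)ᗮ) →ₗ[ℝ] E :=
    { toFun := fun q => hyperplaneMap v q.1 q.2
      map_add' := fun a b => by
        simp only [hyperplaneMap, Prod.fst_add, Prod.snd_add, Submodule.coe_add, add_mul, add_smul]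
        abel
      map_smul' := fun c a => by
        simp [hyperplaneMap, smul_smul, mul_assoc] }
  have hL : Function.Bijective L := by
    constructor
    · intro a b hab
      have h1 : a.1 = b.1 := by
        have := congrArg (inner ℝ v) hab
        simpa only [L, LinearMap.coe_mk, AddHom.coe_mk, inner_hyperplaneMap hv] using this
      have h2 : hyperplaneMap v a.1 a.2 = hyperplaneMap v a.1 b.2 := by
        rw [show hyperplaneMap v a.1 b.2 = hyperplaneMap v b.1 b.2 by rw [h1]]
        exact hab
      exact Prod.ext h1 ((isometry_hyperplaneMap v a.1).injective h2)
    · intro x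
      have hx : x ∈ range (hyperplaneMap v (inner ℝ v x)) := by
        rw [range_hyperplaneMap hv]; rfl
      obtain ⟨z, hz⟩ := hx
      exact ⟨(_, z), hz⟩
  exact ⟨(LinearEquiv.ofBijective L hL).toContinuousLinearEquiv, fun q => rfl⟩

lemma finrank_orthogonal_singleton {v : E} (hv : v ≠ 0) :
    (Module.finrank ℝ (ℝ ∙ v)ᗮ : ℝ) = (Module.finrank ℝ E : ℝ) - 1 := by
  have := Submodule.finrank_add_finrank_orthogonal (K := (ℝ ∙ v))
  rw [finrank_span_singleton hv] at this
  rw [← this]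
  push_cast
  ring

variable [MeasurableSpace E] [BorelSpace E]

/-- The surface measure on the orthogonal complement of `v`. -/
abbrev perpMeasure (v : E) : Measure (ℝ ∙ v)ᗮ :=
  Measure.hausdorffMeasure (Module.finrank ℝ (ℝ ∙ v)ᗮ)

/-- An isometry carries Hausdorff measure to Hausdorff measure restricted to its range. As the
parametrization is a measurable embedding, `F` need not be measurable. -/
lemma setLIntegral_hyperplane {v : E} (hv : v ≠ 0) (t : ℝ) (F : E → ℝ≥0∞) :
    ∫⁻ x in {x | inner ℝ v x = t}, F x
        ∂(Measure.hausdorffMeasure ((Module.finrank ℝ E : ℝ) - 1)) =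
      ∫⁻ z, F (hyperplaneMap v t z) ∂(perpMeasure v) := by
  have hi := isometry_hyperplaneMap v t
  rw [← range_hyperplaneMap hv, ← finrank_orthogonal_singleton hv,
    ← hi.map_hausdorffMeasure (Or.inl (by positivity))]
  exact hi.isClosedEmbedding.measurableEmbedding.lintegral_map _

/-- Uniqueness of Haar measure replaces the computation of a Jacobian. The value of `c` is
irrelevant later; only `0 < c < ∞` and its independence of `F` are used. -/
lemma exists_lintegral_eq_hyperplaneMap {v : E} (hv : v ≠ 0) (m : Measure E)
    [m.IsAddHaarMeasure] :
    ∃ c : ℝ≥0∞, c ≠ 0 ∧ c ≠ ∞ ∧ ∀ F : E → ℝ≥0∞, Measurable F →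
      ∫⁻ x, F x ∂m = c * ∫⁻ t : ℝ, ∫⁻ z, F (hyperplaneMap v t z) ∂(perpMeasure v) := by
  obtain ⟨e, he⟩ := exists_hyperplaneEquiv hv
  let m' : Measure E := ((volume : Measure ℝ).prod (perpMeasure v)).map e
  have hm' : m'.IsAddHaarMeasure := e.isAddHaarMeasure_map _
  have hs := Measure.isAddLeftInvariant_eq_smul m m'
  refine ⟨m.addHaarScalarFactor m', ?_, ENNReal.coe_ne_top, fun F hF => ?_⟩
  · simpa only [ne_eq, ENNReal.coe_eq_zero] using
      (Measure.addHaarScalarFactor_pos_of_isAddHaarMeasure m m').ne'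
  · conv_lhs => rw [hs]
    rw [lintegral_smul_measure, lintegral_map hF e.continuous.measurable, lintegral_prod]
    · simp only [he]; rfl
    · exact (hF.comp e.continuous.measurable).aemeasurable

/-- Integration along the hyperplanes `⟪v, x⟫ + b = t`. -/
lemma exists_lintegral_eq_hyperplane {v : E} (hv : v ≠ 0) (m : Measure E)
    [m.IsAddHaarMeasure] :
    ∃ c : ℝ≥0∞, c ≠ 0 ∧ c ≠ ∞ ∧ ∀ (b : ℝ) (F : E → ℝ≥0∞), Measurable F →
      ∫⁻ x, F x ∂m = c * ∫⁻ t : ℝ, ∫⁻ x in {x | inner ℝ v x + b = t}, F x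
        ∂(Measure.hausdorffMeasure ((Module.finrank ℝ E : ℝ) - 1)) := by
  obtain ⟨c, h0, h1, hc⟩ := exists_lintegral_eq_hyperplaneMap hv m
  refine ⟨c, h0, h1, fun b F hF => ?_⟩
  rw [hc F hF]
  simp_rw [← setLIntegral_hyperplane hv]
  congr 1
  rw [← lintegral_sub_right_eq_self _ b]
  simp only [eq_sub_iff_add_eq]

lemma measurable_setLIntegral_hyperplane {v : E} (hv : v ≠ 0) (b : ℝ) {F : E → ℝ≥0∞}
    (hF : Measurable F) :
    Measurable fun t => ∫⁻ x in {x | inner ℝ v x + b = t}, F x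
        ∂(Measure.hausdorffMeasure ((Module.finrank ℝ E : ℝ) - 1)) := by
  simp_rw [← eq_sub_iff_add_eq, setLIntegral_hyperplane hv]
  have h : Measurable fun q : ℝ × (ℝ ∙ v)ᗮ => F (hyperplaneMap v (q.1 - b) q.2) := by
    refine hF.comp (Continuous.measurable ?_)
    exact (continuous_hyperplaneMap v).comp (by fun_prop : Continuous
      fun q : ℝ × (ℝ ∙ v)ᗮ => (q.1 - b, q.2))
  exact h.lintegral_prod_right'

/-- The distribution of an affine function under a measure with a density has the density given by
the integrals over hyperplanes. -/
lemma map_inner_withDensity {v : E} {b : ℝ} {m : Measure E} {c : ℝ≥0∞}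
    (hc : ∀ F : E → ℝ≥0∞, Measurable F →
      ∫⁻ x, F x ∂m = c * ∫⁻ t : ℝ, ∫⁻ x in {x | inner ℝ v x + b = t}, F x
        ∂(Measure.hausdorffMeasure ((Module.finrank ℝ E : ℝ) - 1)))
    (hv : v ≠ 0) {F : E → ℝ≥0∞} (hF : Measurable F) :
    (m.withDensity F).map (fun x => inner ℝ v x + b) =
      volume.withDensity fun t => c * ∫⁻ x in {x | inner ℝ v x + b = t}, F x
        ∂(Measure.hausdorffMeasure ((Module.finrank ℝ E : ℝ) - 1)) := by
  have hm : Measurable fun x : E => inner ℝ v x + b := by fun_prop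
  ext B hB
  have hB' := hm hB
  rw [Measure.map_apply hm hB, withDensity_apply _ hB', withDensity_apply _ hB,
    lintegral_const_mul _ (measurable_setLIntegral_hyperplane hv b hF), ← lintegral_indicator hB',
    hc _ (hF.indicator hB'), ← lintegral_indicator hB]
  congr 1
  refine lintegral_congr fun t => ?_
  have ht : MeasurableSet {x : E | inner ℝ v x + b = t} := hm (measurableSet_singleton t)
  by_cases h : t ∈ B
  · rw [indicator_of_mem h]
    refine setLIntegral_congr_fun ht fun x hx => ?_
    rw [indicator_of_mem]
    simpa only [mem_preimage, show inner ℝ v x + b = t from hx] using h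
  · rw [indicator_of_notMem h, ← nonpos_iff_eq_zero, ← lintegral_zero]
    refine (setLIntegral_congr_fun ht fun x hx => ?_).le.trans
      (lintegral_mono' Measure.restrict_le_self le_rfl)
    rw [indicator_of_notMem]
    simpa only [mem_preimage, show inner ℝ v x + b = t from hx] using h

end Coarea

/-! ### Laplace asymptotics -/

lemma tendsto_mul_exp_neg_mul {ι : Type*} {l : Filter ι} {η : ι → ℝ} (hη : Tendsto η l atTop)
    {δ : ℝ} (hδ : 0 < δ) : Tendsto (fun n => η n * Real.exp (-(η n * δ))) l (𝓝 0) := by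
  have h := (Real.tendsto_pow_mul_exp_neg_atTop_nhds_zero 1).comp (hη.atTop_mul_const hδ)
  have h2 := h.const_mul δ⁻¹
  rw [mul_zero] at h2
  refine h2.congr fun n => ?_
  simp only [Function.comp, pow_one]
  field_simp

lemma integral_withDensity_eq_integral_toReal {ρ : ℝ → ℝ≥0∞} (hρ : Measurable ρ)
    [IsFiniteMeasure (volume.withDensity ρ)] (φ : ℝ → ℝ) (s : Set ℝ) (hs : MeasurableSet s) :
    ∫ t in s, φ t ∂(volume.withDensity ρ) = ∫ t in s, (ρ t).toReal * φ t := by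
  have hfin : ∀ᵐ t ∂(volume : Measure ℝ), ρ t < ∞ := by
    refine ae_lt_top hρ ?_
    have := measure_lt_top (volume.withDensity ρ) univ
    rw [withDensity_apply _ MeasurableSet.univ, Measure.restrict_univ] at this
    exact this.ne
  rw [restrict_withDensity hs, integral_withDensity_eq_integral_toReal_smul₀ hρ.aemeasurable
    (ae_restrict_of_ae hfin)]
  rfl

/-- Laplace asymptotics at the left end point of the support, for test functions that converge
pointwise and decay uniformly. -/
lemma tendsto_mul_integral_comp_mul {ι : Type*} {l : Filter ι} [l.IsCountablyGenerated]
    {η : ι → ℝ} (hη : Tendsto η l atTop) {ρ : ℝ → ℝ≥0∞} (hρ : Measurable ρ)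
    [IsFiniteMeasure (volume.withDensity ρ)] (hneg : ∀ t < 0, ρ t = 0) (h0 : ρ 0 ≠ ∞)
    (hcont : ContinuousWithinAt ρ (Ici 0) 0) {φ : ι → ℝ → ℝ} {φ' : ℝ → ℝ} {C : ℝ}
    (hφ : ∀ n, Measurable (φ n)) (hC : ∀ᶠ n in l, ∀ s, 0 ≤ s → |φ n s| ≤ C * Real.exp (-s))
    (hlim : ∀ s, 0 < s → Tendsto (fun n => φ n s) l (𝓝 (φ' s))) :
    Tendsto (fun n => η n * ∫ t, φ n (η n * t) ∂(volume.withDensity ρ)) l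
      (𝓝 ((ρ 0).toReal * ∫ s in Ioi 0, φ' s)) := by
  set m := volume.withDensity ρ with hm
  rcases l.eq_or_neBot with rfl | hl
  · exact tendsto_bot
  have hC0 : 0 ≤ C := by
    obtain ⟨n, hn⟩ := hC.exists
    have := (abs_nonneg _).trans (hn 0 le_rfl)
    simpa using this
  have hm0 : m (Iio 0) = 0 := by
    rw [hm, withDensity_apply _ measurableSet_Iio, setLIntegral_congr_fun measurableSet_Iio
      (g := fun _ => 0) (fun t ht => hneg t ht)]
    simp
  -- Continuity at `0` bounds the density only on some `[0, δ]`. Beyond `δ`, finiteness of the total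
  -- mass suffices, since `η e^{-ηδ} → 0`.
  have hr : ∀ᶠ t in 𝓝[≥] (0 : ℝ), ρ t < ρ 0 + 1 :=
    hcont.eventually (gt_mem_nhds (ENNReal.lt_add_right h0 one_ne_zero))
  obtain ⟨δ, hδ, hδr⟩ : ∃ δ > 0, ∀ t, 0 ≤ t → t ≤ δ → ρ t < ρ 0 + 1 := by
    obtain ⟨u, hu, hsub⟩ := mem_nhdsGE_iff_exists_Icc_subset.1 hr
    exact ⟨u, hu, fun t h1 h2 => hsub ⟨h1, h2⟩⟩
  have hcontR : Tendsto (fun t => (ρ t).toReal) (𝓝[≥] 0) (𝓝 (ρ 0).toReal) :=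
    (ENNReal.tendsto_toReal h0).comp hcont
  have hηpos : ∀ᶠ n in l, 0 < η n := hη.eventually_gt_atTop 0
  -- the part away from the end point
  have hfar : Tendsto (fun n => η n * ∫ t in Ioi δ, φ n (η n * t) ∂m) l (𝓝 0) := by
    have hb := (tendsto_mul_exp_neg_mul hη hδ).const_mul (C * m.real univ)
    rw [mul_zero] at hb
    refine squeeze_zero_norm' ?_ hb
    filter_upwards [hC, hηpos] with n hn hpos
    rw [norm_mul, Real.norm_of_nonneg hpos.le]
    have : ‖∫ t in Ioi δ, φ n (η n * t) ∂m‖ ≤ (C * Real.exp (-(η n * δ))) * m.real (Ioi δ) := by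
      refine norm_setIntegral_le_of_norm_le_const (measure_lt_top _ _) fun t ht => ?_
      refine (hn _ (mul_nonneg hpos.le (hδ.le.trans (le_of_lt ht)))).trans ?_
      have : η n * δ ≤ η n * t := by gcongr; exact le_of_lt ht
      gcongr
    calc η n * _ ≤ η n * ((C * Real.exp (-(η n * δ))) * m.real univ) := by
          refine mul_le_mul_of_nonneg_left (this.trans ?_) hpos.le
          gcongr
          · exact measure_ne_top _ _
          · exact subset_univ _
      _ = _ := by ring
  -- the part near the end point
  let G : ι → ℝ → ℝ := fun n s =>
    (Ioc 0 (η n * δ)).indicator (fun s => (ρ ((η n)⁻¹ * s)).toReal * φ n s) s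
  have hnear : Tendsto (fun n => ∫ s, G n s) l (𝓝 (∫ s, (Ioi 0).indicator
      (fun s => (ρ 0).toReal * φ' s) s)) := by
    -- In the variable `s = η t` the density is `ρ (s / η)`, at most `ρ 0 + 1` on the relevant
    -- range, and it tends to `ρ 0`.
    refine tendsto_integral_filter_of_dominated_convergence
      ((Ioi 0).indicator fun s => ((ρ 0).toReal + 1) * (C * Real.exp (-s))) ?_ ?_ ?_ ?_
    · refine Eventually.of_forall fun n => Measurable.aestronglyMeasurable ?_
      refine Measurable.indicator ?_ measurableSet_Ioc
      exact (hρ.comp (measurable_const_mul _)).ennreal_toReal.mul (hφ n)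
    · filter_upwards [hC, hηpos] with n hn hpos
      refine Eventually.of_forall fun s => ?_
      by_cases hs : s ∈ Ioc 0 (η n * δ)
      · simp only [G]
        rw [indicator_of_mem hs, indicator_of_mem (show s ∈ Ioi (0 : ℝ) from hs.1), norm_mul,
          Real.norm_of_nonneg ENNReal.toReal_nonneg]
        refine mul_le_mul ?_ (hn s hs.1.le) (abs_nonneg _) (by positivity)
        have h1 : ρ ((η n)⁻¹ * s) < ρ 0 + 1 := by
          refine hδr _ (by have := hs.1; positivity) ?_
          rw [inv_mul_le_iff₀ hpos]
          exact hs.2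
        have h2 := ENNReal.toReal_mono (ENNReal.add_ne_top.2 ⟨h0, ENNReal.one_ne_top⟩) h1.le
        rwa [ENNReal.toReal_add h0 ENNReal.one_ne_top, ENNReal.toReal_one] at h2
      · simp only [G]
        rw [indicator_of_notMem hs, norm_zero]
        exact indicator_nonneg (fun s _ => by positivity) _
    · rw [integrable_indicator_iff measurableSet_Ioi]
      exact ((integrableOn_exp_neg_Ioi 0).const_mul C).const_mul _
    · refine Eventually.of_forall fun s => ?_
      by_cases hs : 0 < s
      · rw [indicator_of_mem (show s ∈ Ioi (0 : ℝ) from hs)]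
        have hin : Tendsto (fun n => (η n)⁻¹ * s) l (𝓝[≥] 0) := by
          refine tendsto_nhdsWithin_iff.2 ⟨?_, ?_⟩
          · simpa using (tendsto_inv_atTop_zero.comp hη).mul_const s
          · filter_upwards [hηpos] with n hn
            exact mul_nonneg (inv_nonneg.2 hn.le) hs.le
        refine ((hcontR.comp hin).mul (hlim s hs)).congr' ?_
        filter_upwards [(hη.atTop_mul_const hδ).eventually_ge_atTop s] with n hn
        simp only [G, Function.comp]
        rw [indicator_of_mem (show s ∈ Ioc 0 (η n * δ) from ⟨hs, hn⟩)]
      · rw [indicator_of_notMem (show s ∉ Ioi (0 : ℝ) from hs)]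
        refine tendsto_const_nhds.congr fun n => ?_
        simp only [G]
        rw [indicator_of_notMem (fun h => hs h.1)]
  rw [integral_indicator measurableSet_Ioi, integral_const_mul] at hnear
  have hsum := hnear.add hfar
  rw [add_zero] at hsum
  refine hsum.congr' ?_
  filter_upwards [hηpos, hC] with n hpos hn
  have hint : IntegrableOn (fun t => φ n (η n * t)) (Ici 0) m := by
    refine Measure.integrableOn_of_bounded (M := C) (measure_ne_top _ _)
      ((hφ n).comp (measurable_const_mul _)).aestronglyMeasurable ?_
    refine (ae_restrict_iff' measurableSet_Ici).2 (Eventually.of_forall fun t ht => ?_)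
    have h1 : 0 ≤ η n * t := mul_nonneg hpos.le ht
    refine (hn _ h1).trans (mul_le_of_le_one_right hC0 ?_)
    exact Real.exp_le_one_iff.2 (by linarith)
  have hpt : m {0} = 0 := by
    rw [hm, withDensity_apply _ (measurableSet_singleton _)]
    simp
  have hae : (univ : Set ℝ) =ᵐ[m] Ici 0 := by
    refine (eventuallyEq_univ.2 ?_).symm
    rw [mem_ae_iff]
    simpa using hm0
  have hae2 : Icc 0 δ =ᵐ[m] Ioc 0 δ := by
    refine (ae_le_set.2 ?_).antisymm (Eventually.of_forall fun t ht => Ioc_subset_Icc_self ht)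
    refine measure_mono_null (fun t ht => ?_) hpt
    by_contra h
    exact ht.2 ⟨lt_of_le_of_ne ht.1.1 (Ne.symm h), ht.1.2⟩
  have hdisj : Disjoint (Icc 0 δ) (Ioi δ) :=
    Set.disjoint_left.2 fun t h1 h2 => not_lt.2 h1.2 h2
  have hsplit : ∫ t, φ n (η n * t) ∂m =
      ∫ t in Ioc 0 δ, φ n (η n * t) ∂m + ∫ t in Ioi δ, φ n (η n * t) ∂m := by
    rw [← setIntegral_univ, setIntegral_congr_set hae, ← Icc_union_Ioi_eq_Ici hδ.le,
      setIntegral_union hdisj measurableSet_Ioi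
        (hint.mono_set Icc_subset_Ici_self)
        (hint.mono_set (Ioi_subset_Ici_self.trans (Ici_subset_Ici.2 hδ.le))),
      setIntegral_congr_set hae2]
  rw [hsplit, mul_add]
  congr 1
  rw [hm, integral_withDensity_eq_integral_toReal hρ _ _ measurableSet_Ioc,
    ← integral_indicator measurableSet_Ioc]
  have := Measure.integral_comp_mul_left (G n) (η n)
  rw [abs_of_pos (inv_pos.2 hpos), smul_eq_mul] at this
  have h3 : ∫ s, G n s = η n * ∫ t, G n (η n * t) := by
    rw [this]; field_simp
  rw [h3]
  congr 2
  ext t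
  simp only [G, indicator, mem_Ioc, mul_pos_iff_of_pos_left hpos, mul_le_mul_iff_right₀ hpos]
  rw [inv_mul_cancel_left₀ hpos.ne']

/-! ### Power cells -/

section Cells

variable {d n : ℕ} {μ ν : Measure (EuclideanSpace ℝ (Fin d))}
  {p : EuclideanSpace ℝ (Fin d) → ℝ≥0} {y : Fin n → EuclideanSpace ℝ (Fin d)}
  {g : EuclideanSpace ℝ (Fin d) → ℝ}

/-- The `i`-th power cell. -/
def powerCell (y : Fin n → EuclideanSpace ℝ (Fin d)) (g : EuclideanSpace ℝ (Fin d) → ℝ)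
    (i : Fin n) : Set (EuclideanSpace ℝ (Fin d)) :=
  {x | ∀ k, ‖x - y i‖ ^ 2 - g (y i) ≤ ‖x - y k‖ ^ 2 - g (y k)}

lemma cell_zero (i j : Fin n) : cell y g i j 0 = powerCell y g i := by
  simp [cell, powerCell]

lemma mem_cell_iff {i j : Fin n} {a : ℝ} {x : EuclideanSpace ℝ (Fin d)} :
    x ∈ cell y g i j a ↔ ∀ k, (if k ≠ i ∧ k ≠ j then a else 0) ≤ slack y g i k x := by
  simp only [cell, slack, mem_ofPred_eq]
  exact forall_congr' fun k => ⟨fun h => by linarith, fun h => by linarith⟩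

lemma mem_powerCell_iff {i : Fin n} {x : EuclideanSpace ℝ (Fin d)} :
    x ∈ powerCell y g i ↔ ∀ k, 0 ≤ slack y g i k x := by
  simp only [powerCell, slack, mem_ofPred_eq]
  exact forall_congr' fun k => ⟨fun h => by linarith, fun h => by linarith⟩

lemma slack_self (i : Fin n) (x : EuclideanSpace ℝ (Fin d)) : slack y g i i x = 0 := by
  simp [slack]

lemma slack_swap (i j : Fin n) (x : EuclideanSpace ℝ (Fin d)) :
    slack y g j i x = -slack y g i j x := by
  simp [slack]

lemma slack_eq_inner (i j : Fin n) (x : EuclideanSpace ℝ (Fin d)) :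
    slack y g i j x = inner ℝ ((2 : ℝ) • (y i - y j)) x +
      (‖y j‖ ^ 2 - ‖y i‖ ^ 2 - g (y j) + g (y i)) := by
  rw [slack, norm_sub_sq_real, norm_sub_sq_real, inner_smul_left, inner_sub_left,
    real_inner_comm x, real_inner_comm x]
  simp
  ring

lemma continuous_slack (i j : Fin n) : Continuous (slack y g i j) := by
  unfold slack; fun_prop

lemma isClosed_cell (i j : Fin n) (a : ℝ) : IsClosed (cell y g i j a) := by
  simp only [cell, ofPred_forall]
  exact isClosed_iInter fun k => isClosed_le (by fun_prop) (by fun_prop)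

lemma isClosed_powerCell (i : Fin n) : IsClosed (powerCell y g i) :=
  cell_zero (y := y) (g := g) i i ▸ isClosed_cell i i 0

lemma convex_powerCell (i : Fin n) : Convex ℝ (powerCell y g i) := by
  have : powerCell y g i = ⋂ k, {x | 0 ≤ slack y g i k x} := by
    ext x; simp [mem_powerCell_iff]
  rw [this]
  refine convex_iInter fun k => ?_
  simp_rw [slack_eq_inner, ← neg_le_iff_add_nonneg]
  exact convex_halfSpace_ge (𝕜 := ℝ) (IsLinearMap.mk (fun a b => inner_add_right _ a b)
    fun c a => by rw [inner_smul_right, smul_eq_mul]) _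

lemma cell_subset_powerCell {i j : Fin n} {a : ℝ} (ha : 0 ≤ a) :
    cell y g i j a ⊆ powerCell y g i := by
  intro x hx
  rw [mem_powerCell_iff]
  intro k
  refine le_trans ?_ (mem_cell_iff.1 hx k)
  split_ifs <;> simp [ha]

lemma two_smul_sub_ne_zero (hy : Function.Injective y) {i j : Fin n} (hij : i ≠ j) :
    (2 : ℝ) • (y i - y j) ≠ 0 :=
  smul_ne_zero two_ne_zero (sub_ne_zero.2 fun h => hij (hy h))

lemma ae_inner_ne {E : Type*} [NormedAddCommGroup E] [InnerProductSpace ℝ E]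
    [FiniteDimensional ℝ E] [MeasurableSpace E] [BorelSpace E] (m : Measure E)
    [m.IsAddHaarMeasure] {v : E} (hv : v ≠ 0) (t : ℝ) : ∀ᵐ x ∂m, inner ℝ v x ≠ t := by
  have hs : Function.Surjective ((innerSL ℝ v : E →L[ℝ] ℝ) : E →ₗ[ℝ] ℝ) := by
    refine LinearMap.surjective fun h => hv ?_
    have := LinearMap.congr_fun h v
    simpa using this
  have := (ae_comp_linearMap_mem_iff _ m volume hs
    (measurableSet_singleton t).compl).2 (by simp [ae_iff])
  simpa using this

lemma IsRegularSource.absolutelyContinuous (hμ : IsRegularSource μ p) : μ ≪ volume := by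
  rw [hμ.eq_withDensity]
  exact withDensity_absolutelyContinuous _ _

lemma ae_slack_ne (hy : Function.Injective y) (hμ : μ ≪ volume) :
    ∀ᵐ x ∂μ, ∀ i j, i ≠ j → slack y g i j x ≠ 0 := by
  suffices h : ∀ᵐ x ∂(volume : Measure (EuclideanSpace ℝ (Fin d))),
      ∀ i j, i ≠ j → slack y g i j x ≠ 0 from hμ.ae_le h
  rw [ae_all_iff]
  intro i
  rw [ae_all_iff]
  intro j
  by_cases hij : i = j
  · simp [hij]
  filter_upwards [ae_inner_ne volume (two_smul_sub_ne_zero hy hij)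
    (-(‖y j‖ ^ 2 - ‖y i‖ ^ 2 - g (y j) + g (y i)))] with x hx _ h
  rw [slack_eq_inner] at h
  exact hx (by linarith)

lemma iUnion_powerCell [NeZero n] : ⋃ i, powerCell y g i = univ := by
  refine eq_univ_of_forall fun x => mem_iUnion.2 ?_
  obtain ⟨i, hi⟩ := Finite.exists_min fun k => ‖x - y k‖ ^ 2 - g (y k)
  exact ⟨i, hi⟩

lemma aedisjoint_powerCell (hy : Function.Injective y) (hμ : μ ≪ volume) :
    Pairwise (Function.onFun (AEDisjoint μ) (powerCell y g)) := by
  intro i j hij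
  refine measure_mono_null (t := {x | ¬ ∀ i j, i ≠ j → slack y g i j x ≠ 0}) ?_
    (ae_slack_ne hy hμ)
  rintro x ⟨h1, h2⟩ h
  refine h i j hij (le_antisymm ?_ (mem_powerCell_iff.1 h1 j))
  have := mem_powerCell_iff.1 h2 i
  rw [slack_swap] at this
  linarith

lemma sum_measure_powerCell [NeZero n] (hy : Function.Injective y) (hμ : μ ≪ volume) :
    ∑ i, μ (powerCell y g i) = μ univ := by
  rw [← iUnion_powerCell (y := y) (g := g), measure_iUnion₀ (aedisjoint_powerCell hy hμ)
    fun i => (isClosed_powerCell i).measurableSet.nullMeasurableSet, tsum_fintype]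

lemma integral_eq_sum_powerCell [NeZero n] (hy : Function.Injective y) (hμ : μ ≪ volume)
    {F : EuclideanSpace ℝ (Fin d) → ℝ} (hF : Integrable F μ) :
    ∫ x, F x ∂μ = ∑ i, ∫ x in powerCell y g i, F x ∂μ := by
  rw [← setIntegral_univ, ← iUnion_powerCell (y := y) (g := g), integral_iUnion_ae
    (fun i => (isClosed_powerCell i).measurableSet.nullMeasurableSet)
    (aedisjoint_powerCell hy hμ) hF.integrableOn, tsum_fintype]

end Cells

/-! ### Optimality conditions -/

section Optimality

variable {d n : ℕ} {μ ν : Measure (EuclideanSpace ℝ (Fin d))}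
  {p : EuclideanSpace ℝ (Fin d) → ℝ≥0} {y : Fin n → EuclideanSpace ℝ (Fin d)}
  {f g : EuclideanSpace ℝ (Fin d) → ℝ}

/-- The `c`-transform of the dual weights `a`. -/
def powerMin (y : Fin n → EuclideanSpace ℝ (Fin d)) (a : Fin n → ℝ)
    (x : EuclideanSpace ℝ (Fin d)) : ℝ := ⨅ k, (‖x - y k‖ ^ 2 - a k)

/-- The partition function of the dual weights `a`. -/
def gibbsSum (y : Fin n → EuclideanSpace ℝ (Fin d)) (η : ℝ) (a : Fin n → ℝ)
    (x : EuclideanSpace ℝ (Fin d)) : ℝ := ∑ k, Real.exp (-η * (‖x - y k‖ ^ 2 - a k))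

/-- The entropic `c`-transform of the dual weights `a`. -/
def softMin (y : Fin n → EuclideanSpace ℝ (Fin d)) (η : ℝ) (a : Fin n → ℝ)
    (x : EuclideanSpace ℝ (Fin d)) : ℝ := -(1 / η) * Real.log (gibbsSum y η a x)

lemma powerMin_le (a : Fin n → ℝ) (x : EuclideanSpace ℝ (Fin d)) (k : Fin n) :
    powerMin y a x ≤ ‖x - y k‖ ^ 2 - a k :=
  ciInf_le (Set.finite_range _).bddBelow k

lemma powerMin_eq {i : Fin n} {x : EuclideanSpace ℝ (Fin d)} (hx : x ∈ powerCell y g i) :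
    powerMin y (g ∘ y) x = ‖x - y i‖ ^ 2 - g (y i) :=
  have : Nonempty (Fin n) := ⟨i⟩
  le_antisymm (powerMin_le _ _ _) (le_ciInf hx)

lemma gibbsSum_pos [NeZero n] (η : ℝ) (a : Fin n → ℝ) (x : EuclideanSpace ℝ (Fin d)) :
    0 < gibbsSum y η a x :=
  Finset.sum_pos (fun _ _ => Real.exp_pos _) ⟨0, Finset.mem_univ _⟩

lemma continuous_gibbsSum (η : ℝ) (a : Fin n → ℝ) : Continuous (gibbsSum y η a) := by
  unfold gibbsSum; fun_prop

lemma continuous_softMin [NeZero n] (η : ℝ) (a : Fin n → ℝ) : Continuous (softMin y η a) :=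
  continuous_const.mul ((continuous_gibbsSum η a).log fun x => (gibbsSum_pos η a x).ne')

lemma exp_mul_softMin [NeZero n] {η : ℝ} (hη : 0 < η) (a : Fin n → ℝ)
    (x : EuclideanSpace ℝ (Fin d)) :
    Real.exp (-(η * softMin y η a x)) = gibbsSum y η a x := by
  rw [softMin, show -(η * (-(1 / η) * Real.log (gibbsSum y η a x))) =
    Real.log (gibbsSum y η a x) by field_simp, Real.exp_log (gibbsSum_pos η a x)]

/-- Factoring the partition function out of the sum of exponentials makes the dependence on `f`
pointwise, through `f - softMin` alone. -/
lemma entropicDual_eq [NeZero n] {η : ℝ} (hη : 0 < η) (hf : AEMeasurable f μ)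
    (g : EuclideanSpace ℝ (Fin d) → ℝ) :
    entropicDual μ ν y η f g = ((∫ x, f x ∂μ + ∫ z, g z ∂ν + 1 / η : ℝ) : EReal) -
      ((ENNReal.ofReal (1 / η) * ∫⁻ x, ENNReal.ofReal
        (Real.exp (η * (f x - softMin y η (g ∘ y) x))) ∂μ : ℝ≥0∞) : EReal) := by
  rw [entropicDual, ← lintegral_finsetSum']
  · congr 3
    refine lintegral_congr fun x => ?_
    rw [← ENNReal.ofReal_sum_of_nonneg fun i _ => (Real.exp_pos _).le]
    congr 1
    rw [mul_sub, sub_eq_add_neg, Real.exp_add, exp_mul_softMin hη, gibbsSum, Finset.mul_sum]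
    refine Finset.sum_congr rfl fun k _ => ?_
    rw [← Real.exp_add]
    congr 1
    simp only [Function.comp]
    ring
  · intro k _
    fun_prop

/-- At the optimal `f` the exponential term has total mass one and cancels the constant `1 / η`,
leaving the semi-dual functional. -/
lemma entropicDual_softMin [NeZero n] [IsProbabilityMeasure μ] {η : ℝ} (hη : 0 < η)
    (g : EuclideanSpace ℝ (Fin d) → ℝ) :
    entropicDual μ ν y η (softMin y η (g ∘ y)) g =
      ((∫ x, softMin y η (g ∘ y) x ∂μ + ∫ z, g z ∂ν : ℝ) : EReal) := by
  rw [entropicDual_eq hη (continuous_softMin η _).measurable.aemeasurable]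
  simp only [sub_self, mul_zero, Real.exp_zero, ENNReal.ofReal_one, lintegral_const, measure_univ,
    mul_one]
  rw [EReal.coe_ennreal_ofReal, max_eq_left (by positivity), ← EReal.coe_sub]
  congr 1
  ring

lemma IsFinitelySupportedOn.restrict_range (hν : IsFinitelySupportedOn ν y) :
    ν.restrict (⋃ i, {y i}) = ν := by
  rw [iUnion_singleton_eq_range]
  exact Measure.restrict_eq_self_of_ae_mem hν.compl_null

variable [IsProbabilityMeasure ν]

lemma IsFinitelySupportedOn.neZero (hν : IsFinitelySupportedOn ν y) : NeZero n := by
  refine ⟨fun h => ?_⟩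
  subst h
  have := hν.compl_null
  simp at this

lemma IsFinitelySupportedOn.integrable (hν : IsFinitelySupportedOn ν y)
    (g : EuclideanSpace ℝ (Fin d) → ℝ) : Integrable g ν := by
  rw [← hν.restrict_range]
  refine integrableOn_finite_iUnion.2 fun i => integrableOn_singleton (hx := measure_lt_top _ _)

lemma IsFinitelySupportedOn.integral_eq (hν : IsFinitelySupportedOn ν y)
    (g : EuclideanSpace ℝ (Fin d) → ℝ) : ∫ z, g z ∂ν = ∑ i, ν.real {y i} * g (y i) := by
  conv_lhs => rw [← hν.restrict_range]
  rw [integral_iUnion_fintype (fun i => measurableSet_singleton _)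
    (fun i j hij => by simpa using fun h => hij (hν.injective h))
    (fun i => (hν.integrable g).integrableOn)]
  simp [measureReal_def]

variable [IsProbabilityMeasure μ]

lemma integrable_sq_norm_sub (h2 : Integrable (fun x => ‖x‖ ^ 2) μ)
    (z : EuclideanSpace ℝ (Fin d)) : Integrable (fun x => ‖x - z‖ ^ 2) μ := by
  refine Integrable.mono' ((h2.const_mul 2).add (integrable_const (2 * ‖z‖ ^ 2)))
    (by fun_prop) (Eventually.of_forall fun x => ?_)
  rw [Real.norm_of_nonneg (by positivity), Pi.add_apply]
  have h1 := norm_sub_le x z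
  nlinarith [sq_nonneg (‖x‖ - ‖z‖), norm_nonneg (x - z), norm_nonneg x, norm_nonneg z]

lemma integrable_powerMin [NeZero n] (h2 : Integrable (fun x => ‖x‖ ^ 2) μ) (a : Fin n → ℝ) :
    Integrable (powerMin y a) μ := by
  refine Integrable.mono' (((integrable_sq_norm_sub h2 (y 0)).add
    (integrable_const (∑ k, |a k|)))) ?_ (Eventually.of_forall fun x => ?_)
  · refine Measurable.aestronglyMeasurable (Measurable.iInf fun _ => ?_)
    fun_prop
  · have hk : ∀ k, |a k| ≤ ∑ k, |a k| := fun k =>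
      Finset.single_le_sum (f := fun k => |a k|) (fun i _ => abs_nonneg _) (Finset.mem_univ k)
    rw [Real.norm_eq_abs, abs_le, Pi.add_apply]
    constructor
    · refine le_ciInf fun k => ?_
      have h1 := (abs_le.1 (hk k)).2
      nlinarith [sq_nonneg ‖x - y k‖, sq_nonneg ‖x - y 0‖]
    · refine (powerMin_le a x 0).trans ?_
      have h1 := (abs_le.1 (hk 0)).1
      linarith

lemma integrable_softMin [NeZero n] (h2 : Integrable (fun x => ‖x‖ ^ 2) μ) {η : ℝ} (hη : 0 < η)
    (a : Fin n → ℝ) : Integrable (softMin y η a) μ := by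
  refine Integrable.mono' (((integrable_sq_norm_sub h2 (y 0)).add
    (integrable_const (|a 0| + |1 / η * Real.log (∑ k, Real.exp (η * a k))|))))
    (continuous_softMin η a).aestronglyMeasurable (Eventually.of_forall fun x => ?_)
  rw [Real.norm_eq_abs, abs_le, Pi.add_apply]
  have ha := neg_abs_le (a 0)
  have hl := le_abs_self (1 / η * Real.log (∑ k, Real.exp (η * a k)))
  constructor
  · have h1 : gibbsSum y η a x ≤ ∑ k, Real.exp (η * a k) := by
      refine Finset.sum_le_sum fun k _ => Real.exp_le_exp.2 ?_
      nlinarith [mul_nonneg hη.le (sq_nonneg ‖x - y k‖)]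
    have h3 := mul_le_mul_of_nonneg_left (Real.log_le_log (gibbsSum_pos η a x) h1)
      (one_div_pos.2 hη).le
    rw [softMin]
    nlinarith [sq_nonneg ‖x - y 0‖, abs_nonneg (a 0)]
  · have h1 : Real.exp (-η * (‖x - y 0‖ ^ 2 - a 0)) ≤ gibbsSum y η a x :=
      Finset.single_le_sum (f := fun k => Real.exp (-η * (‖x - y k‖ ^ 2 - a k)))
        (fun i _ => (Real.exp_pos _).le) (Finset.mem_univ 0)
    rw [← exp_mul_softMin hη, Real.exp_le_exp] at h1
    have h3 : softMin y η a x ≤ ‖x - y 0‖ ^ 2 - a 0 := le_of_mul_le_mul_left (by linarith) hη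
    have := abs_nonneg (1 / η * Real.log (∑ k, Real.exp (η * a k)))
    linarith

/-! #### The entropic problem -/

-- With `D = f - softMin`, replacing `f` by `softMin` gains `∫ ((e^{ηD} - 1) / η - D)`. The
-- integrand is nonnegative by `e^x ≥ 1 + x` and vanishes only where `D = 0`, so optimality forces
-- `D = 0` almost everywhere.
set_option linter.unusedSectionVars false in
lemma IsEntropicPotentials.ae_eq_softMin [NeZero n] {η : ℝ} (hη : 0 < η)
    (h2 : Integrable (fun x => ‖x‖ ^ 2) μ) (h : IsEntropicPotentials μ ν y η f g) :
    f =ᵐ[μ] softMin y η (g ∘ y) := by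
  set G := softMin y η (g ∘ y) with hG
  have hGi : Integrable G μ := integrable_softMin h2 hη _
  have hle := h.optimal G g hGi h.integrable_right
  rw [hG, entropicDual_softMin hη, ← hG, entropicDual_eq hη h.integrable_left.aemeasurable,
    ← hG] at hle
  -- A non-integrable exponential would give the objective value `-∞`, below that of the competitor.
  have hfin : ∫⁻ x, ENNReal.ofReal (Real.exp (η * (f x - G x))) ∂μ ≠ ∞ := by
    intro htop
    rw [htop, ENNReal.mul_top (by simpa using hη), EReal.coe_ennreal_top, EReal.sub_top,
      le_bot_iff] at hle
    exact EReal.coe_ne_bot _ hle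
  have hmeas : AEStronglyMeasurable (fun x => Real.exp (η * (f x - G x))) μ := by
    have := h.integrable_left.aestronglyMeasurable
    have := hGi.aestronglyMeasurable
    fun_prop
  have hXi : Integrable (fun x => Real.exp (η * (f x - G x))) μ :=
    (lintegral_ofReal_ne_top_iff_integrable hmeas
      (Eventually.of_forall fun x => (Real.exp_pos _).le)).1 hfin
  rw [← ofReal_integral_eq_lintegral_ofReal hXi (Eventually.of_forall fun x =>
    (Real.exp_pos _).le), ← ENNReal.ofReal_mul (by positivity), EReal.coe_ennreal_ofReal,
    max_eq_left (mul_nonneg (by positivity) (integral_nonneg fun x => (Real.exp_pos _).le)),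
    ← EReal.coe_sub, EReal.coe_le_coe_iff] at hle
  have hDi : Integrable (fun x => 1 / η * Real.exp (η * (f x - G x)) - 1 / η - (f x - G x)) μ :=
    ((hXi.const_mul _).sub (integrable_const _)).sub (h.integrable_left.sub hGi)
  have hnn : ∀ x, 0 ≤ 1 / η * Real.exp (η * (f x - G x)) - 1 / η - (f x - G x) := fun x => by
    have h1 := mul_le_mul_of_nonneg_left (Real.add_one_le_exp (η * (f x - G x)))
      (one_div_pos.2 hη).le
    have h3 : 1 / η * (η * (f x - G x) + 1) = f x - G x + 1 / η := by field_simp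
    linarith
  have hint : ∫ x, (1 / η * Real.exp (η * (f x - G x)) - 1 / η - (f x - G x)) ∂μ = 0 := by
    refine le_antisymm ?_ (integral_nonneg hnn)
    have e1 : ∫ x, (1 / η * Real.exp (η * (f x - G x)) - 1 / η - (f x - G x)) ∂μ =
        ∫ x, (1 / η * Real.exp (η * (f x - G x)) - 1 / η) ∂μ - ∫ x, (f x - G x) ∂μ :=
      integral_sub ((hXi.const_mul _).sub (integrable_const _)) (h.integrable_left.sub hGi)
    have e2 : ∫ x, (1 / η * Real.exp (η * (f x - G x)) - 1 / η) ∂μ =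
        1 / η * ∫ x, Real.exp (η * (f x - G x)) ∂μ - 1 / η := by
      rw [integral_sub (hXi.const_mul _) (integrable_const _), integral_const_mul]
      simp
    rw [e1, e2, integral_sub h.integrable_left hGi]
    linarith
  filter_upwards [(integral_eq_zero_iff_of_nonneg hnn hDi).1 hint] with x hx
  by_contra hne
  have h1 := mul_lt_mul_of_pos_left (Real.add_one_lt_exp (x := η * (f x - G x))
    (mul_ne_zero hη.ne' (sub_ne_zero.2 hne))) (one_div_pos.2 hη)
  have h3 : 1 / η * (η * (f x - G x) + 1) = f x - G x + 1 / η := by field_simp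
  simp only [Pi.zero_apply] at hx
  linarith

/-- The entropic potentials maximize the semi-dual functional. -/
lemma IsEntropicPotentials.integral_softMin_le [NeZero n] {η : ℝ} (hη : 0 < η)
    (h2 : Integrable (fun x => ‖x‖ ^ 2) μ) (h : IsEntropicPotentials μ ν y η f g)
    {g' : EuclideanSpace ℝ (Fin d) → ℝ} (hg' : Integrable g' ν) (h0 : ∫ z, g' z ∂ν = 0) :
    ∫ x, softMin y η (g' ∘ y) x ∂μ ≤ ∫ x, softMin y η (g ∘ y) x ∂μ := by
  have hle := h.optimal (softMin y η (g' ∘ y)) g' (integrable_softMin h2 hη (g' ∘ y)) hg'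
  have hf := h.ae_eq_softMin hη h2
  have heq : entropicDual μ ν y η f g = entropicDual μ ν y η (softMin y η (g ∘ y)) g := by
    rw [entropicDual_eq hη h.integrable_left.aemeasurable,
      entropicDual_eq hη (continuous_softMin η _).measurable.aemeasurable, integral_congr_ae hf]
    congr 3
    refine lintegral_congr_ae ?_
    filter_upwards [hf] with x hx
    rw [hx]
  rw [heq, entropicDual_softMin hη, entropicDual_softMin hη, EReal.coe_le_coe_iff, h0,
    h.normalized] at hle
  linarith

/-! #### The unregularized problem -/

lemma isDualFeasible_powerMin [NeZero n] (hν : IsFinitelySupportedOn ν y)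
    (h2 : Integrable (fun x => ‖x‖ ^ 2) μ) (g : EuclideanSpace ℝ (Fin d) → ℝ) :
    IsDualFeasible μ ν y (powerMin y (g ∘ y)) g where
  integrable_left := integrable_powerMin h2 _
  integrable_right := hν.integrable g
  le_cost := Eventually.of_forall fun x i => by
    have := powerMin_le (y := y) (g ∘ y) x i
    simp only [Function.comp] at this ⊢
    linarith

lemma IsOptimalPotentials.ae_eq_powerMin [NeZero n] (hν : IsFinitelySupportedOn ν y)
    (h2 : Integrable (fun x => ‖x‖ ^ 2) μ) (h : IsOptimalPotentials μ ν y f g) :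
    f =ᵐ[μ] powerMin y (g ∘ y) := by
  have hle : f ≤ᵐ[μ] powerMin y (g ∘ y) := by
    filter_upwards [h.feasible.le_cost] with x hx
    exact le_ciInf fun k => le_sub_iff_add_le.2 (hx k)
  have hi : Integrable (powerMin y (g ∘ y)) μ := integrable_powerMin h2 _
  have := h.optimal _ g (isDualFeasible_powerMin hν h2 g)
  exact (integral_eq_iff_of_ae_le h.feasible.integrable_left hi hle).1
    (le_antisymm (integral_mono_ae h.feasible.integrable_left hi hle) (by linarith))

/-- Raising the weight of `y i` by `ε` gains `ε ν {y i}` and lowers the transform by at most `ε`,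
and only on the enlarged cell `A ε`. Optimality gives `ν {y i} ≤ μ (A ε)`, and the sets `A ε`
decrease to the power cell. -/
lemma IsOptimalPotentials.measure_le [NeZero n] (hν : IsFinitelySupportedOn ν y)
    (h2 : Integrable (fun x => ‖x‖ ^ 2) μ) (h : IsOptimalPotentials μ ν y f g) (i : Fin n) :
    ν {y i} ≤ μ (powerCell y g i) := by
  classical
  let A : ℝ → Set (EuclideanSpace ℝ (Fin d)) := fun ε =>
    {x | ∀ k, ‖x - y i‖ ^ 2 - g (y i) - ε ≤ ‖x - y k‖ ^ 2 - g (y k)}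
  have hAc : ∀ ε, IsClosed (A ε) := fun ε => by
    simp only [A, ofPred_forall]
    exact isClosed_iInter fun k => isClosed_le (by fun_prop) (by fun_prop)
  have hA : ∀ ε, 0 < ε → ν {y i} ≤ μ (A ε) := fun ε hε => by
    let g' : EuclideanSpace ℝ (Fin d) → ℝ := fun z => g z + ε * (if z = y i then 1 else 0)
    have hg'y : ∀ k, g' (y k) = g (y k) + if k = i then ε else 0 := fun k => by
      simp [g', hν.injective.eq_iff]
    have hint : ∫ z, g' z ∂ν = ∫ z, g z ∂ν + ε * ν.real {y i} := by
      rw [hν.integral_eq, hν.integral_eq]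
      simp only [hg'y, mul_add, Finset.sum_add_distrib]
      simp [mul_comm]
    have hpt : ∀ x, powerMin y (g ∘ y) x - (A ε).indicator (fun _ => ε) x ≤
        powerMin y (g' ∘ y) x := fun x => by
      refine le_ciInf fun k => ?_
      simp only [Function.comp, hg'y]
      have h1 := powerMin_le (y := y) (g ∘ y) x k
      simp only [Function.comp] at h1
      by_cases hx : x ∈ A ε
      · rw [indicator_of_mem hx]
        split_ifs <;> linarith
      · rw [indicator_of_notMem hx]
        split_ifs with hk
        · simp only [A, mem_ofPred_eq, not_forall, not_le] at hx
          obtain ⟨l, hl⟩ := hx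
          have h3 := powerMin_le (y := y) (g ∘ y) x l
          simp only [Function.comp] at h3
          subst hk
          linarith
        · linarith
    have hi : Integrable (powerMin y (g ∘ y)) μ := integrable_powerMin h2 _
    have hind : Integrable ((A ε).indicator fun _ => ε) μ :=
      (integrable_const ε).indicator (hAc ε).measurableSet
    have h1 := integral_mono (hi.sub hind) (integrable_powerMin h2 _) hpt
    simp only [Pi.sub_apply] at h1
    rw [integral_sub hi hind, integral_indicator_const _ (hAc ε).measurableSet, smul_eq_mul] at h1
    have h3 := h.optimal _ g' (isDualFeasible_powerMin hν h2 g')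
    rw [hint, integral_congr_ae (h.ae_eq_powerMin hν h2)] at h3
    have h4 : ν.real {y i} * ε ≤ μ.real (A ε) * ε := by linarith
    exact (ENNReal.toReal_le_toReal (measure_ne_top _ _) (measure_ne_top _ _)).1
      (le_of_mul_le_mul_right h4 hε)
  have hInter : powerCell y g i = ⋂ m : ℕ, A (1 / ((m : ℝ) + 1)) := by
    ext x
    simp only [powerCell, mem_ofPred_eq, mem_iInter, A]
    refine ⟨fun hx m k => ?_, fun hx k => ?_⟩
    · have : 0 < 1 / ((m : ℝ) + 1) := Nat.one_div_pos_of_nat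
      linarith [hx k]
    · refine le_of_forall_pos_le_add fun ε hε => ?_
      obtain ⟨m, hm⟩ := exists_nat_one_div_lt hε
      linarith [hx m k]
  have hanti : Antitone fun m : ℕ => A (1 / ((m : ℝ) + 1)) := fun m m' hm x hx k => by
    have : 1 / ((m' : ℝ) + 1) ≤ 1 / ((m : ℝ) + 1) := Nat.one_div_le_one_div hm
    linarith [hx k]
  rw [hInter]
  exact ge_of_tendsto' (tendsto_measure_iInter_atTop
    (fun m => (hAc _).measurableSet.nullMeasurableSet) hanti ⟨0, measure_ne_top _ _⟩)
    fun m => hA _ Nat.one_div_pos_of_nat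

/-- The power cells of the optimal potentials have the masses of the points. -/
lemma IsOptimalPotentials.measure_powerCell [NeZero n] (hν : IsFinitelySupportedOn ν y)
    (h2 : Integrable (fun x => ‖x‖ ^ 2) μ) (hac : μ ≪ volume)
    (h : IsOptimalPotentials μ ν y f g) (i : Fin n) :
    μ (powerCell y g i) = ν {y i} := by
  -- Both families of masses sum to one, so none of the inequalities of `measure_le` can be strict.
  have hsum : ∑ i, ν {y i} = 1 := by
    rw [← tsum_fintype (L := .unconditional _), ← measure_iUnion (fun i j hij => by
      simpa using fun h => hij (hν.injective h)) (fun i => measurableSet_singleton _),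
      ← Measure.restrict_apply_univ, hν.restrict_range, measure_univ]
  have hsum' : ∑ i, μ (powerCell y g i) = 1 := by
    rw [sum_measure_powerCell hν.injective hac, measure_univ]
  have hle := h.measure_le hν h2
  refine le_antisymm (not_lt.1 fun hlt => ?_) (hle i)
  refine absurd (hsum.trans hsum'.symm) (ne_of_lt ?_)
  rw [← Finset.add_sum_erase _ _ (Finset.mem_univ i), ← Finset.add_sum_erase (a := i) _
    (fun i => μ (powerCell y g i)) (Finset.mem_univ i)]
  refine ENNReal.add_lt_add_of_lt_of_le ?_ hlt (Finset.sum_le_sum fun k _ => hle k)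
  exact ENNReal.sum_ne_top.2 fun k _ => measure_ne_top _ _

end Optimality

/-! ### Interfaces between cells -/

/-- The cylinder over a null subset of a hyperplane is Lebesgue-null. -/
lemma measure_cylinder_eq_zero {E : Type*} [NormedAddCommGroup E] [InnerProductSpace ℝ E]
    [FiniteDimensional ℝ E] [MeasurableSpace E] [BorelSpace E] (m : Measure E)
    [m.IsAddHaarMeasure] {v : E} (hv : v ≠ 0) (b : ℝ) {N : Set E} (hN : MeasurableSet N)
    (hNv : ∀ x ∈ N, inner ℝ v x + b = 0)
    (hN0 : Measure.hausdorffMeasure ((Module.finrank ℝ E : ℝ) - 1) N = 0) (e : E) :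
    m {z | ∃ s : ℝ, z + s • e ∈ N} = 0 := by
  have hkey : ∀ z (s : ℝ), z + s • e ∈ N → inner ℝ v z + b + s * inner ℝ v e = 0 := by
    intro z s hz
    have := hNv _ hz
    rw [inner_add_right, inner_smul_right] at this
    linarith
  -- If `e` is parallel to the hyperplane, the cylinder never leaves that hyperplane.
  by_cases he : inner ℝ v e = 0
  · refine measure_mono_null ?_ (ae_inner_ne m hv (-b))
    rintro z ⟨s, hs⟩ h
    have := hkey z s hs
    rw [he] at this
    exact h (by linarith)
  -- `P` is the projection along `e` onto the hyperplane. The cylinder meets each parallel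
  -- hyperplane in a translate of `N`, so Fubini applies.
  let P : E → E := fun z => z + (-(inner ℝ v z + b) / inner ℝ v e) • e
  have hP : Continuous P := by fun_prop
  have hT := hP.measurable hN
  refine measure_mono_null (t := P ⁻¹' N) ?_ ?_
  · rintro z ⟨s, hs⟩
    have : s = -(inner ℝ v z + b) / inner ℝ v e := by
      rw [eq_div_iff he]
      linarith [hkey z s hs]
    simpa only [P, mem_preimage, ← this] using hs
  obtain ⟨c, -, -, hc⟩ := exists_lintegral_eq_hyperplane hv m
  have h1 := hc b ((P ⁻¹' N).indicator 1) (measurable_one.indicator hT)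
  rw [lintegral_indicator_one hT] at h1
  rw [h1]
  refine mul_eq_zero_of_right _ ?_
  rw [← lintegral_zero (μ := (volume : Measure ℝ))]
  refine lintegral_congr fun t => ?_
  rw [lintegral_indicator_one hT, Measure.restrict_apply hT]
  refine measure_mono_null (t := (IsometryEquiv.addRight ((-t / inner ℝ v e) • e)) ⁻¹' N) ?_ ?_
  · rintro z ⟨hz, hzt⟩
    rw [mem_ofPred_eq] at hzt
    simp only [P, mem_preimage, hzt] at hz
    exact hz
  · rw [IsometryEquiv.hausdorffMeasure_preimage, hN0]

section Interfaces

variable {d n : ℕ} {μ ν : Measure (EuclideanSpace ℝ (Fin d))}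
  {p : EuclideanSpace ℝ (Fin d) → ℝ≥0} {y : Fin n → EuclideanSpace ℝ (Fin d)}
  {g : EuclideanSpace ℝ (Fin d) → ℝ}

lemma IsRegularSource.measure_compl_interior (hμ : IsRegularSource μ p) :
    μ (interior μ.support)ᶜ = 0 := by
  refine measure_mono_null (t := μ.supportᶜ ∪ frontier μ.support) ?_ ?_
  · intro x hx
    by_cases h : x ∈ μ.support
    · exact Or.inr ⟨subset_closure h, hx⟩
    · exact Or.inl h
  · exact measure_union_null Measure.measure_compl_support
      (hμ.absolutelyContinuous hμ.frontier_null)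

lemma mem_slice_zero_iff {i j : Fin n} {x : EuclideanSpace ℝ (Fin d)} :
    x ∈ slice y g i j 0 0 ↔ x ∈ powerCell y g i ∧ x ∈ powerCell y g j := by
  simp only [slice, mem_ofPred_eq, cell_zero, mem_powerCell_iff]
  have key : ∀ k, slack y g j k x = slack y g i k x - slack y g i j x := fun k => by
    simp only [slack]; ring
  constructor
  · rintro ⟨h1, h2⟩
    exact ⟨h1, fun k => by rw [key, h2, sub_zero]; exact h1 k⟩
  · rintro ⟨h1, h2⟩
    refine ⟨h1, le_antisymm ?_ (h1 j)⟩
    have := h2 i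
    rw [slack_swap] at this
    linarith

lemma measurableSet_slice (i j : Fin n) (t a : ℝ) : MeasurableSet (slice y g i j t a) :=
  (isClosed_cell i j a).measurableSet.inter
    ((continuous_slack i j).measurable (measurableSet_singleton t))

/-- A closed convex set with empty interior equals its frontier and is Lebesgue-null, so a cell of
positive mass has interior points. -/
lemma closure_interior_powerCell (hμ : μ ≪ volume) {i : Fin n}
    (hi : μ (powerCell y g i) ≠ 0) :
    closure (interior (powerCell y g i)) = powerCell y g i := by
  have hc := convex_powerCell (y := y) (g := g) i
  rw [hc.closure_interior_eq_closure_of_nonempty_interior, (isClosed_powerCell i).closure_eq]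
  by_contra hemp
  rw [not_nonempty_iff_eq_empty] at hemp
  refine hi (hμ ?_)
  have := hc.addHaar_frontier volume
  rwa [(isClosed_powerCell i).frontier_eq, hemp, sdiff_empty] at this

/-- Two complementary families of cells meet in an interface of positive mass. -/
lemma exists_sliceMass_ne_zero [NeZero n] (hμ : IsRegularSource μ p) (hy : Function.Injective y)
    (hpos : ∀ i, μ (powerCell y g i) ≠ 0) {A : Set (Fin n)} (hA : A.Nonempty)
    (hA' : Aᶜ.Nonempty) :
    ∃ k ∈ A, ∃ l ∉ A, sliceMass p y g k l 0 0 ≠ 0 := by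
  by_contra! hzero
  set U := interior μ.support with hU
  have hac := hμ.absolutelyContinuous
  let S : Set (Fin n) → Set (EuclideanSpace ℝ (Fin d)) := fun B => ⋃ k ∈ B, powerCell y g k
  have hScl : ∀ B, IsClosed (S B) := fun B =>
    B.toFinite.isClosed_biUnion fun k _ => isClosed_powerCell k
  have hSU : ∀ x, x ∈ S A ∪ S Aᶜ := fun x => by
    have : x ∈ ⋃ i, powerCell y g i := by rw [iUnion_powerCell]; trivial
    obtain ⟨i, hi⟩ := mem_iUnion.1 this
    by_cases h : i ∈ A
    · exact Or.inl (mem_biUnion h hi)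
    · exact Or.inr (mem_biUnion (show i ∈ Aᶜ from h) hi)
  have hmeet : ∀ B : Set (Fin n), B.Nonempty → (U ∩ S B).Nonempty := by
    rintro B ⟨i, hi⟩
    by_contra hemp
    rw [not_nonempty_iff_eq_empty] at hemp
    refine hpos i (measure_mono_null (t := Uᶜ) (fun x hx hxU => ?_) hμ.measure_compl_interior)
    have : x ∈ U ∩ S B := ⟨hxU, mem_biUnion hi hx⟩
    rw [hemp] at this
    exact this
  -- Two closed sets that cover the connected set `U`, and both meet it, have a common point in `U`.
  -- Near this point there are small balls inside either union, and the ball around it keeps the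
  -- segments between them in `U`.
  obtain ⟨x, hxU, hxA, hxA'⟩ := isPreconnected_closed_iff.1 hμ.connected.isPreconnected (S A)
    (S Aᶜ) (hScl _) (hScl _) (fun x _ => hSU x) (hmeet A hA) (hmeet _ hA')
  obtain ⟨r, hr, hball⟩ := Metric.isOpen_iff.1 isOpen_interior x hxU
  have hnear : ∀ B, x ∈ S B → ∃ z ρ, 0 < ρ ∧ Metric.ball z ρ ⊆ S B ∩ Metric.ball x r := by
    intro B hxB
    obtain ⟨i, hi, hxi⟩ := mem_iUnion₂.1 hxB
    rw [← closure_interior_powerCell hac (hpos i)] at hxi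
    obtain ⟨z, hz1, hz2⟩ := mem_closure_iff.1 hxi _ Metric.isOpen_ball (Metric.mem_ball_self hr)
    obtain ⟨ρ, hρ, hρs⟩ := Metric.isOpen_iff.1 (Metric.isOpen_ball.inter isOpen_interior) z
      ⟨hz1, hz2⟩
    exact ⟨z, ρ, hρ, fun w hw => ⟨mem_biUnion hi (interior_subset (hρs hw).2), (hρs hw).1⟩⟩
  obtain ⟨z₀, ρ₀, hρ₀, h₀⟩ := hnear A hxA
  obtain ⟨z₁, ρ₁, hρ₁, h₁⟩ := hnear Aᶜ hxA'
  set e := z₁ - z₀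
  let N : Fin n → Fin n → Set (EuclideanSpace ℝ (Fin d)) := fun k l => slice y g k l 0 0 ∩ U
  -- Translation by `e` moves a ball inside `S A` into `S Aᶜ`. Each translation segment crosses an
  -- interface within `U`, so the ball lies in the cylinders over these interfaces; if all were
  -- null, so would be the ball.
  have hcover : Metric.ball z₀ (min ρ₀ ρ₁) ⊆
      ⋃ k ∈ A, ⋃ l ∈ Aᶜ, {z | ∃ s : ℝ, z + s • e ∈ N k l} := by
    intro z hz
    have hz0 := h₀ (Metric.ball_subset_ball (min_le_left _ _) hz)
    have hz1 : z + e ∈ S Aᶜ ∩ Metric.ball x r := by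
      refine h₁ (Metric.ball_subset_ball (min_le_right ρ₀ ρ₁) ?_)
      rw [Metric.mem_ball, dist_eq_norm] at hz ⊢
      rwa [show z + e - z₁ = z - z₀ by simp only [e]; abel]
    have hseg : IsPreconnected (segment ℝ z (z + e)) := (convex_segment _ _).isPreconnected
    obtain ⟨w, hw, hwA, hwA'⟩ := isPreconnected_closed_iff.1 hseg (S A) (S Aᶜ) (hScl _) (hScl _)
      (fun x _ => hSU x) ⟨z, left_mem_segment _ _ _, hz0.1⟩ ⟨z + e, right_mem_segment _ _ _, hz1.1⟩
    have hwU : w ∈ U := hball ((convex_ball x r).segment_subset hz0.2 hz1.2 hw)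
    rw [segment_eq_image'] at hw
    obtain ⟨s, -, rfl⟩ := hw
    obtain ⟨k, hk, hwk⟩ := mem_iUnion₂.1 hwA
    obtain ⟨l, hl, hwl⟩ := mem_iUnion₂.1 hwA'
    refine mem_biUnion hk (mem_biUnion hl ⟨s, ?_⟩)
    simp only [add_sub_cancel_left] at hwk hwl hwU
    exact ⟨mem_slice_zero_iff.2 ⟨hwk, hwl⟩, hwU⟩
  have hnull : volume (Metric.ball z₀ (min ρ₀ ρ₁)) = 0 := by
    refine measure_mono_null hcover ?_
    refine (measure_biUnion_null_iff A.to_countable).2 fun k hk =>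
      (measure_biUnion_null_iff (to_countable _)).2 fun l hl => ?_
    have hkl : k ≠ l := fun h => hl (h ▸ hk)
    have hUm : MeasurableSet U := isOpen_interior.measurableSet
    refine measure_cylinder_eq_zero volume (two_smul_sub_ne_zero hy hkl) _
      ((measurableSet_slice k l 0 0).inter hUm) (fun x hx => (slack_eq_inner k l x).symm.trans
        hx.1.2) ?_ e
    -- As `p > 0` on `U`, a slice of zero mass is Hausdorff-null inside `U`.
    have h := hzero k hk l hl
    rw [sliceMass, lintegral_eq_zero_iff (by have := hμ.measurable_density; fun_prop)] at h
    rw [finrank_euclideanSpace_fin, inter_comm, ← Measure.restrict_apply hUm]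
    refine measure_mono_null (t := {x | (p x : ℝ≥0∞) = 0}ᶜ) (fun x hx h' => ?_) h
    rw [mem_ofPred_eq, ENNReal.coe_eq_zero] at h'
    exact (hμ.density_pos x hx).ne' h'
  exact (Metric.measure_ball_pos volume z₀ (lt_min hρ₀ hρ₁)).ne' hnull

end Interfaces

/-! ### Continuous compactly supported densities -/

section ContinuousDensity

variable {d n : ℕ} {μ ν : Measure (EuclideanSpace ℝ (Fin d))}
  {p : EuclideanSpace ℝ (Fin d) → ℝ≥0} {y : Fin n → EuclideanSpace ℝ (Fin d)}
  {g : EuclideanSpace ℝ (Fin d) → ℝ}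

/-- The constant term of the slack `Δᵢⱼ`. -/
def slackConst (y : Fin n → EuclideanSpace ℝ (Fin d)) (g : EuclideanSpace ℝ (Fin d) → ℝ)
    (i j : Fin n) : ℝ := ‖y j‖ ^ 2 - ‖y i‖ ^ 2 - g (y j) + g (y i)

lemma sliceMass_eq_setLIntegral (i j : Fin n) (t a : ℝ) :
    sliceMass p y g i j t a =
      ∫⁻ x in {x | inner ℝ ((2 : ℝ) • (y i - y j)) x + slackConst y g i j = t},
        (cell y g i j a).indicator (fun x => (p x : ℝ≥0∞)) x
        ∂(Measure.hausdorffMeasure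
          ((Module.finrank ℝ (EuclideanSpace ℝ (Fin d)) : ℝ) - 1)) := by
  rw [setLIntegral_indicator (isClosed_cell i j a).measurableSet, finrank_euclideanSpace_fin,
    sliceMass]
  congr 2
  ext x
  simp only [slice, mem_ofPred_eq, mem_inter_iff, slack_eq_inner, slackConst]

lemma sliceMass_eq_lintegral (hy : Function.Injective y) {i j : Fin n} (hij : i ≠ j) (t a : ℝ) :
    sliceMass p y g i j t a =
      ∫⁻ z, (cell y g i j a).indicator (fun x => (p x : ℝ≥0∞))
        (hyperplaneMap ((2 : ℝ) • (y i - y j)) (t - slackConst y g i j) z)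
        ∂(perpMeasure ((2 : ℝ) • (y i - y j))) := by
  rw [sliceMass_eq_setLIntegral, ← setLIntegral_hyperplane (two_smul_sub_ne_zero hy hij)]
  simp only [eq_sub_iff_add_eq]

lemma exists_mem_powerCell (hac : μ ≪ volume) (hy : Function.Injective y) {k : Fin n}
    (hk : μ (powerCell y g k) ≠ 0) :
    ∃ x ∈ powerCell y g k, ∀ i j, i ≠ j → slack y g i j x ≠ 0 := by
  by_contra! h
  refine hk (measure_mono_null (t := {x | ∀ i j, i ≠ j → slack y g i j x ≠ 0}ᶜ)
    (fun x hx h' => ?_) (ae_slack_ne hy hac))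
  obtain ⟨i, j, hij, h0⟩ := h x hx
  exact h' i j hij h0

/-- If all cells have positive mass, then the hyperplanes of two neighbours of a cell do not
coincide. -/
lemma not_forall_slack_eq_mul (hac : μ ≪ volume) (hy : Function.Injective y)
    (hpos : ∀ i, μ (powerCell y g i) ≠ 0) {i j k : Fin n} (hij : i ≠ j) (hik : k ≠ i)
    (hkj : k ≠ j) (c : ℝ) : ¬ ∀ x, slack y g i k x = c * slack y g i j x := by
  intro h
  have key : ∀ x, slack y g j k x = slack y g i k x - slack y g i j x := fun x => by
    simp only [slack]; ring
  obtain ⟨xi, hxi, hi⟩ := exists_mem_powerCell hac hy (hpos i)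
  obtain ⟨xj, hxj, hj⟩ := exists_mem_powerCell hac hy (hpos j)
  obtain ⟨xk, hxk, hk⟩ := exists_mem_powerCell hac hy (hpos k)
  rw [mem_powerCell_iff] at hxi hxj hxk
  have i1 := lt_of_le_of_ne (hxi j) (hi i j hij).symm
  have i2 := hxi k
  -- The points of cells `i` and `j` force `0 ≤ c ≤ 1`. The point of cell `k` then forces `c = 0` or
  -- `c = 1`, which would put it on a hyperplane that it avoids.
  have hc0 : 0 ≤ c := by
    rw [h] at i2
    exact nonneg_of_mul_nonneg_left i2 i1
  have j1 := lt_of_le_of_ne (hxj i) (hj j i hij.symm).symm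
  have j2 := hxj k
  have hc1 : c ≤ 1 := by
    rw [key, h] at j2
    rw [slack_swap] at j1
    nlinarith
  have k1 := hk i k hik.symm
  have k2 := hk j k hkj.symm
  have k3 := hxk i
  have k4 := hxk j
  have k5 := hk i j hij
  rw [slack_swap i, h] at k3
  rw [slack_swap j, key, h] at k4
  rw [h] at k1
  rw [key, h] at k2
  rcases lt_or_gt_of_ne k5 with h5 | h5
  · have : c = 1 := by nlinarith
    exact k2 (by rw [this]; ring)
  · have : c = 0 := by nlinarith
    exact k1 (by rw [this]; ring)

/-- Almost everywhere on the hyperplane `Δᵢⱼ = 0`, no other slack is equal to a given small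
number. -/
lemma eventually_ae_slack_ne (hac : μ ≪ volume) (hy : Function.Injective y)
    (hpos : ∀ i, μ (powerCell y g i) ≠ 0) {i j : Fin n} (hij : i ≠ j) :
    ∀ᶠ a in 𝓝 (0 : ℝ), ∀ᵐ z ∂(perpMeasure ((2 : ℝ) • (y i - y j))), ∀ k, k ≠ i → k ≠ j →
      slack y g i k (hyperplaneMap ((2 : ℝ) • (y i - y j)) (0 - slackConst y g i j) z) ≠ a := by
  simp_rw [ae_all_iff]
  refine eventually_all.2 fun k => eventually_imp_distrib_left.2 fun hki =>
    eventually_imp_distrib_left.2 fun hkj => ?_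
  set v := (2 : ℝ) • (y i - y j) with hv
  set w := (2 : ℝ) • (y i - y k) with hw
  have hv0 : v ≠ 0 := two_smul_sub_ne_zero hy hij
  set x₀ := hyperplaneMap v (0 - slackConst y g i j) 0 with hx₀
  have hslack : ∀ z : (ℝ ∙ v)ᗮ, slack y g i k (hyperplaneMap v (0 - slackConst y g i j) z) =
      inner ℝ ((ℝ ∙ v)ᗮ.orthogonalProjectionOnto w) z + slack y g i k x₀ := by
    intro z
    rw [slack_eq_inner, slack_eq_inner, ← hw,
      Submodule.inner_orthogonalProjectionOnto_eq_of_mem_right, hx₀]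
    simp only [hyperplaneMap, inner_add_right, Submodule.coe_zero, inner_zero_right]
    ring
  -- On the hyperplane `Δᵢⱼ = 0` the slack `Δᵢₖ` is affine with gradient the projection of `w`. If
  -- this vanishes, `Δᵢₖ` is a nonzero constant there and small `a` are avoided; otherwise every
  -- level set is null.
  by_cases hproj : (ℝ ∙ v)ᗮ.orthogonalProjectionOnto w = 0
  · have hne : slack y g i k x₀ ≠ 0 := by
      intro h0
      rw [Submodule.orthogonalProjectionOnto_eq_zero_iff, Submodule.orthogonal_orthogonal,
        Submodule.mem_span_singleton] at hproj
      obtain ⟨c, hc⟩ := hproj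
      refine not_forall_slack_eq_mul hac hy hpos hij hki hkj c fun x => ?_
      have h1 : slack y g i j x₀ = 0 := by
        rw [slack_eq_inner, ← hv, hx₀, inner_hyperplaneMap hv0, slackConst]
        ring
      rw [slack_eq_inner, ← hw, ← hc, inner_smul_left] at h0 ⊢
      rw [slack_eq_inner, ← hv] at h1 ⊢
      simp only [conj_trivial] at h0 ⊢
      linear_combination h0 - c * h1
    filter_upwards [isOpen_ne.mem_nhds hne.symm] with a ha
    refine Eventually.of_forall fun z => ?_
    rw [hslack, hproj, inner_zero_left, zero_add]
    exact Ne.symm ha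
  · refine Eventually.of_forall fun a => ?_
    filter_upwards [ae_inner_ne (perpMeasure v) hproj (a - slack y g i k x₀)] with z hz h
    rw [hslack] at h
    exact hz (by linarith)

/-- This confines the support of the integrand to one ball of the parameter space, uniformly in `t`.
-/
lemma norm_le_norm_hyperplaneMap {E : Type*} [NormedAddCommGroup E] [InnerProductSpace ℝ E]
    (v : E) (t : ℝ) (z : (ℝ ∙ v)ᗮ) : ‖z‖ ≤ ‖hyperplaneMap v t z‖ := by
  have h : inner ℝ v (z : E) = 0 := Submodule.mem_orthogonal_singleton_iff_inner_right.1 z.2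
  have h1 : inner ℝ (z : E) (hyperplaneMap v t z) = ‖(z : E)‖ * ‖(z : E)‖ := by
    rw [hyperplaneMap, inner_add_right, inner_smul_right, real_inner_comm v, h, mul_zero, add_zero,
      real_inner_self_eq_norm_mul_norm]
  have h2 := real_inner_le_norm (z : E) (hyperplaneMap v t z)
  rw [h1] at h2
  rcases (norm_nonneg (z : E)).eq_or_lt with h3 | h3
  · rw [Submodule.coe_norm, ← h3]; positivity
  · exact le_of_mul_le_mul_left h2 h3

lemma eq_zero_of_notMem_support (hμ : IsRegularSource μ p) (hp : Continuous p)
    {x : EuclideanSpace ℝ (Fin d)} (hx : x ∉ μ.support) : p x = 0 := by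
  by_contra hne
  have hopen : IsOpen (μ.supportᶜ ∩ {x | p x ≠ 0}) :=
    Measure.isOpen_compl_support.inter (isOpen_ne_fun hp continuous_const)
  refine (hopen.measure_pos volume ⟨x, hx, hne⟩).ne' ?_
  have h := Measure.measure_compl_support (μ := μ)
  have hm : MeasurableSet μ.supportᶜ := Measure.isOpen_compl_support.measurableSet
  have hmeas := hμ.measurable_density
  conv at h => lhs; arg 1; rw [hμ.eq_withDensity]
  rw [withDensity_apply _ hm, lintegral_eq_zero_iff (by fun_prop)] at h
  rw [inter_comm, ← Measure.restrict_apply' hm]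
  refine measure_mono_null (t := {x | (p x : ℝ≥0∞) = 0}ᶜ) (fun x hx h' => ?_) h
  rw [mem_ofPred_eq, ENNReal.coe_eq_zero] at h'
  exact hx h'

lemma exists_density_le (hμ : IsRegularSource μ p) (hp : Continuous p)
    (hK : IsCompact μ.support) :
    ∃ (M : ℝ≥0) (R : ℝ), ∀ x, p x ≤ M ∧ (p x ≠ 0 → ‖x‖ ≤ R) := by
  obtain ⟨R, hR⟩ := hK.isBounded.exists_norm_le
  obtain ⟨M, hM⟩ := hK.bddAbove_image hp.continuousOn
  refine ⟨M, R, fun x => ⟨?_, fun h => hR x ?_⟩⟩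
  · by_cases hx : x ∈ μ.support
    · exact hM ⟨x, hx, rfl⟩
    · rw [eq_zero_of_notMem_support hμ hp hx]; positivity
  · by_contra hx
    exact h (eq_zero_of_notMem_support hμ hp hx)

/-- Parametrizing all slices by the same space reduces continuity in `t` and in `a` to one dominated
convergence. By `hne` almost no point lies on the boundary of a constraint `k ≠ i, j`, so membership
in the cell is eventually constant; the constraint `k = j` reads `0 ≤ t`. -/
lemma tendsto_sliceMass (hμ : IsRegularSource μ p) (hp : Continuous p)
    (hK : IsCompact μ.support) (hy : Function.Injective y) {i j : Fin n} (hij : i ≠ j) {a₀ : ℝ}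
    (hne : ∀ᵐ z ∂(perpMeasure ((2 : ℝ) • (y i - y j))), ∀ k, k ≠ i → k ≠ j →
      slack y g i k (hyperplaneMap ((2 : ℝ) • (y i - y j)) (0 - slackConst y g i j) z) ≠ a₀)
    {ι : Type*} {l : Filter ι} [l.IsCountablyGenerated] {t a : ι → ℝ}
    (ht : Tendsto t l (𝓝 0)) (ht0 : ∀ᶠ m in l, 0 ≤ t m) (ha : Tendsto a l (𝓝 a₀)) :
    Tendsto (fun m => sliceMass p y g i j (t m) (a m)) l (𝓝 (sliceMass p y g i j 0 a₀)) ∧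
      sliceMass p y g i j 0 a₀ ≠ ∞ := by
  simp_rw [sliceMass_eq_lintegral hy hij]
  set v := (2 : ℝ) • (y i - y j) with hv
  set b := slackConst y g i j with hb
  have hv0 : v ≠ 0 := two_smul_sub_ne_zero hy hij
  obtain ⟨M, R, hMR⟩ := exists_density_le hμ hp hK
  have hbound : ∀ (s a : ℝ) z, (cell y g i j a).indicator (fun x => (p x : ℝ≥0∞))
      (hyperplaneMap v s z) ≤ (Metric.closedBall 0 R).indicator (fun _ => (M : ℝ≥0∞)) z := by
    intro s a z
    refine (indicator_le_self _ _ _).trans ?_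
    by_cases hz : z ∈ Metric.closedBall 0 R
    · rw [indicator_of_mem hz]
      exact ENNReal.coe_le_coe.2 (hMR _).1
    · rw [indicator_of_notMem hz, nonpos_iff_eq_zero, ENNReal.coe_eq_zero]
      by_contra h
      refine hz ?_
      rw [mem_closedBall_zero_iff]
      exact (norm_le_norm_hyperplaneMap v s z).trans ((hMR _).2 h)
  have hfin : ∫⁻ z, (Metric.closedBall 0 R).indicator (fun _ => (M : ℝ≥0∞)) z
      ∂(perpMeasure v) ≠ ∞ := by
    rw [lintegral_indicator_const Metric.isClosed_closedBall.measurableSet]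
    exact ENNReal.mul_ne_top ENNReal.coe_ne_top (isCompact_closedBall _ _).measure_lt_top.ne
  refine ⟨?_, ((lintegral_mono fun z => hbound _ _ z).trans_lt hfin.lt_top).ne⟩
  refine tendsto_lintegral_filter_of_dominated_convergence _ (Eventually.of_forall fun m => ?_)
    (Eventually.of_forall fun m => Eventually.of_forall fun z => hbound _ _ z) hfin ?_
  · have := hμ.measurable_density
    exact (Measurable.indicator (by fun_prop) (isClosed_cell i j _).measurableSet).comp
      (isometry_hyperplaneMap v _).continuous.measurable
  filter_upwards [hne] with z hz
  have hx : Tendsto (fun m => hyperplaneMap v (t m - b) z) l (𝓝 (hyperplaneMap v (0 - b) z)) := by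
    have h1 := ((continuous_hyperplaneMap v).tendsto (0 - b, z)).comp
      ((ht.sub_const b).prodMk_nhds tendsto_const_nhds)
    exact h1
  have hs : ∀ k, Tendsto (fun m => slack y g i k (hyperplaneMap v (t m - b) z)) l
      (𝓝 (slack y g i k (hyperplaneMap v (0 - b) z))) := fun k =>
    ((continuous_slack i k).tendsto _).comp hx
  have hsj : ∀ s, slack y g i j (hyperplaneMap v (s - b) z) = s := fun s => by
    rw [slack_eq_inner, ← hv, inner_hyperplaneMap hv0, hb, slackConst]
    ring
  by_cases hmem : hyperplaneMap v (0 - b) z ∈ cell y g i j a₀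
  · have hev : ∀ᶠ m in l, hyperplaneMap v (t m - b) z ∈ cell y g i j (a m) := by
      simp_rw [mem_cell_iff]
      refine eventually_all.2 fun k => ?_
      by_cases hk : k ≠ i ∧ k ≠ j
      · simp_rw [if_pos hk]
        have h1 := mem_cell_iff.1 hmem k
        rw [if_pos hk] at h1
        have h2 := lt_of_le_of_ne h1 (hz k hk.1 hk.2).symm
        exact (ha.eventually_lt (hs k) h2).mono fun m hm => hm.le
      · simp_rw [if_neg hk]
        rw [not_and_or, not_not, not_not] at hk
        rcases hk with rfl | rfl
        · exact Eventually.of_forall fun m => (slack_self _ _).ge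
        · simpa only [hsj] using ht0
    rw [indicator_of_mem hmem]
    refine (((ENNReal.continuous_coe.comp hp).tendsto _).comp hx).congr' ?_
    filter_upwards [hev] with m hm
    rw [indicator_of_mem hm]
    rfl
  · have hev : ∀ᶠ m in l, hyperplaneMap v (t m - b) z ∉ cell y g i j (a m) := by
      have h1 := hmem
      rw [mem_cell_iff, not_forall] at h1
      obtain ⟨k, hk⟩ := h1
      rw [not_le] at hk
      by_cases hkk : k ≠ i ∧ k ≠ j
      · rw [if_pos hkk] at hk
        filter_upwards [(hs k).eventually_lt ha hk] with m hm hmc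
        have := mem_cell_iff.1 hmc k
        rw [if_pos hkk] at this
        linarith
      · rw [if_neg hkk] at hk
        rw [not_and_or, not_not, not_not] at hkk
        rcases hkk with rfl | rfl
        · rw [slack_self] at hk; exact absurd hk (lt_irrefl _)
        · rw [hsj] at hk; exact absurd hk (lt_irrefl _)
    rw [indicator_of_notMem hmem]
    refine tendsto_const_nhds.congr' ?_
    filter_upwards [hev] with m hm
    rw [indicator_of_notMem hm]

/-- Compactly supported continuous densities are continuous along the hyperplanes. -/
lemma IsContinuousAlongHyperplanes.of_continuous (hμ : IsRegularSource μ p) (hp : Continuous p)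
    (hK : IsCompact μ.support) (hy : Function.Injective y)
    (hpos : ∀ i, μ (powerCell y g i) ≠ 0) : IsContinuousAlongHyperplanes p y g where
  finite i j hij :=
    (tendsto_sliceMass hμ hp hK hy hij (eventually_ae_slack_ne hμ.absolutelyContinuous hy hpos
      hij).self_of_nhds (l := 𝓝 (0 : ℝ)) (t := fun _ => 0) (a := id) tendsto_const_nhds
      (Eventually.of_forall fun _ => le_rfl) tendsto_id).2
  continuous_slice i j hij := by
    filter_upwards [(eventually_ae_slack_ne hμ.absolutelyContinuous hy hpos hij).filter_mono
      nhdsWithin_le_nhds] with a ha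
    exact (tendsto_sliceMass hμ hp hK hy hij ha (l := 𝓝[≥] (0 : ℝ)) (t := id) (a := fun _ => a)
      nhdsWithin_le_nhds self_mem_nhdsWithin tendsto_const_nhds).1
  continuous_push i j hij :=
    (tendsto_sliceMass hμ hp hK hy hij (eventually_ae_slack_ne hμ.absolutelyContinuous hy hpos
      hij).self_of_nhds (l := 𝓝[≥] (0 : ℝ)) (t := fun _ => 0) (a := id) tendsto_const_nhds
      (Eventually.of_forall fun _ => le_rfl) nhdsWithin_le_nhds).1

end ContinuousDensity

/-! ### Laplace asymptotics on cells -/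

section CellAsymptotics

variable {d n : ℕ} {μ ν : Measure (EuclideanSpace ℝ (Fin d))}
  {p : EuclideanSpace ℝ (Fin d) → ℝ≥0} {y : Fin n → EuclideanSpace ℝ (Fin d)}
  {g : EuclideanSpace ℝ (Fin d) → ℝ}

lemma slack_eq_inner_add_apply (i j : Fin n) (x : EuclideanSpace ℝ (Fin d)) :
    slack y g i j x = inner ℝ ((2 : ℝ) • (y i - y j)) x + slackConst y g i j :=
  slack_eq_inner i j x

lemma slack_eq_inner_add (i j : Fin n) :
    slack y g i j = fun x => inner ℝ ((2 : ℝ) • (y i - y j)) x + slackConst y g i j :=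
  funext fun x => slack_eq_inner i j x

lemma map_slack_restrict_cell (hμ : IsRegularSource μ p) (hy : Function.Injective y)
    {i j : Fin n} (hij : i ≠ j) {c : ℝ≥0∞}
    (hc : ∀ F : EuclideanSpace ℝ (Fin d) → ℝ≥0∞, Measurable F →
      ∫⁻ x, F x = c * ∫⁻ t : ℝ, ∫⁻ x in
        {x | inner ℝ ((2 : ℝ) • (y i - y j)) x + slackConst y g i j = t}, F x
        ∂(Measure.hausdorffMeasure
          ((Module.finrank ℝ (EuclideanSpace ℝ (Fin d)) : ℝ) - 1))) (a : ℝ) :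
    (Measurable fun t => sliceMass p y g i j t a) ∧
      (μ.restrict (cell y g i j a)).map (slack y g i j) =
        volume.withDensity fun t => c * sliceMass p y g i j t a := by
  have hm := (isClosed_cell (y := y) (g := g) i j a).measurableSet
  have hF : Measurable ((cell y g i j a).indicator fun x => (p x : ℝ≥0∞)) := by
    have := hμ.measurable_density
    exact Measurable.indicator (by fun_prop) hm
  simp_rw [sliceMass_eq_setLIntegral]
  refine ⟨measurable_setLIntegral_hyperplane (two_smul_sub_ne_zero hy hij) _ hF, ?_⟩
  rw [← map_inner_withDensity hc (two_smul_sub_ne_zero hy hij) hF, ← slack_eq_inner_add,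
    withDensity_indicator hm, ← restrict_withDensity hm, ← hμ.eq_withDensity]

/-- The distributions of the slacks `Δᵢⱼ` and `Δⱼᵢ` on the cells have densities given by the slice
masses, with the same constant. -/
lemma exists_map_slack_restrict_cell (hμ : IsRegularSource μ p) (hy : Function.Injective y)
    {i j : Fin n} (hij : i ≠ j) :
    ∃ c : ℝ≥0∞, c ≠ 0 ∧ c ≠ ∞ ∧ ∀ a : ℝ,
      ((Measurable fun t => sliceMass p y g i j t a) ∧
        (μ.restrict (cell y g i j a)).map (slack y g i j) =
          volume.withDensity fun t => c * sliceMass p y g i j t a) ∧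
      ((Measurable fun t => sliceMass p y g j i t a) ∧
        (μ.restrict (cell y g j i a)).map (slack y g j i) =
          volume.withDensity fun t => c * sliceMass p y g j i t a) := by
  obtain ⟨c, h0, h1, hc⟩ := exists_lintegral_eq_hyperplane (two_smul_sub_ne_zero hy hij)
    (volume : Measure (EuclideanSpace ℝ (Fin d)))
  refine ⟨c, h0, h1, fun a => ⟨map_slack_restrict_cell hμ hy hij (hc _) a,
    map_slack_restrict_cell hμ hy hij.symm (fun F hF => ?_) a⟩⟩
  -- The reflection `t ↦ -t` exchanges the level sets of `Δᵢⱼ` and `Δⱼᵢ`. Having the same `c` for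
  -- both is what makes the Laplace limits symmetric.
  rw [hc (slackConst y g i j) F hF, ← lintegral_neg_eq_self]
  congr 2
  funext t
  congr 2
  ext x
  rw [mem_ofPred_eq, mem_ofPred_eq, ← slack_eq_inner_add_apply, ← slack_eq_inner_add_apply,
    slack_swap i j, neg_eq_iff_eq_neg]

/-- The number `r` is the limit of the Laplace functionals of the slack `Δᵢⱼ` on `S`. -/
def IsLaplaceLimit (μ : Measure (EuclideanSpace ℝ (Fin d))) (S : Set (EuclideanSpace ℝ (Fin d)))
    (Δ : EuclideanSpace ℝ (Fin d) → ℝ) (r : ℝ) : Prop :=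
  ∀ (η : ℕ → ℝ) (φ : ℕ → ℝ → ℝ) (φ' : ℝ → ℝ) (C : ℝ), Tendsto η atTop atTop →
    (∀ m, Measurable (φ m)) → (∀ᶠ m in atTop, ∀ s, 0 ≤ s → |φ m s| ≤ C * Real.exp (-s)) →
    (∀ s, 0 < s → Tendsto (fun m => φ m s) atTop (𝓝 (φ' s))) →
    Tendsto (fun m => η m * ∫ x in S, φ m (η m * Δ x) ∂μ) atTop (𝓝 (r * ∫ s in Ioi 0, φ' s))

lemma isLaplaceLimit_cell [IsFiniteMeasure μ] {i j : Fin n} {a : ℝ} (ha : 0 ≤ a) {c : ℝ≥0∞}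
    (hc : c ≠ ∞) (hm : Measurable fun t => sliceMass p y g i j t a)
    (hmap : (μ.restrict (cell y g i j a)).map (slack y g i j) =
      volume.withDensity fun t => c * sliceMass p y g i j t a)
    (hfin : sliceMass p y g i j 0 a ≠ ∞)
    (hcont : ContinuousWithinAt (fun t => sliceMass p y g i j t a) (Ici 0) 0) :
    IsLaplaceLimit μ (cell y g i j a) (slack y g i j) (c * sliceMass p y g i j 0 a).toReal := by
  intro η φ φ' C hη hφ hC hlim
  have hfm : IsFiniteMeasure (volume.withDensity fun t => c * sliceMass p y g i j t a) := by
    rw [← hmap]; infer_instance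
  have hneg : ∀ t < 0, c * sliceMass p y g i j t a = 0 := fun t ht => by
    have : slice y g i j t a = ∅ := by
      refine eq_empty_of_forall_notMem fun x hx => ?_
      have := mem_powerCell_iff.1 (cell_subset_powerCell ha hx.1) j
      rw [hx.2] at this
      linarith
    rw [sliceMass, this]
    simp
  have hcc : ContinuousWithinAt (fun t => c * sliceMass p y g i j t a) (Ici 0) 0 :=
    ENNReal.Tendsto.const_mul hcont (Or.inr hc)
  have key := tendsto_mul_integral_comp_mul hη (hm.const_mul c) hneg (ENNReal.mul_ne_top hc hfin)
    hcc hφ hC hlim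
  refine key.congr fun m => ?_
  rw [← hmap, integral_map (continuous_slack i j).measurable.aemeasurable]
  exact ((hφ m).comp (measurable_const_mul _)).aestronglyMeasurable

/-- Testing with `e^{-s}` recovers `r`. Uniqueness is needed because the limits for `(i, j)` and
`(j, i)` are chosen independently. -/
lemma IsLaplaceLimit.unique {S : Set (EuclideanSpace ℝ (Fin d))}
    {Δ : EuclideanSpace ℝ (Fin d) → ℝ} {r r' : ℝ} (h : IsLaplaceLimit μ S Δ r)
    (h' : IsLaplaceLimit μ S Δ r') : r = r' := by
  have hC : ∀ᶠ m : ℕ in atTop, ∀ s : ℝ, 0 ≤ s → |Real.exp (-s)| ≤ 1 * Real.exp (-s) :=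
    Eventually.of_forall fun m s _ => by rw [abs_of_pos (Real.exp_pos _), one_mul]
  have h1 := h (fun m => m) (fun _ s => Real.exp (-s)) (fun s => Real.exp (-s)) 1
    tendsto_natCast_atTop_atTop (fun _ => by fun_prop) hC fun _ _ => tendsto_const_nhds
  have h2 := h' (fun m => m) (fun _ s => Real.exp (-s)) (fun s => Real.exp (-s)) 1
    tendsto_natCast_atTop_atTop (fun _ => by fun_prop) hC fun _ _ => tendsto_const_nhds
  have := tendsto_nhds_unique h1 h2
  rwa [integral_exp_neg_Ioi_zero, mul_one, mul_one] at this

lemma slice_comm (i j : Fin n) : slice y g i j 0 0 = slice y g j i 0 0 := by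
  ext x
  rw [mem_slice_zero_iff, mem_slice_zero_iff, and_comm]

lemma sliceMass_comm (i j : Fin n) : sliceMass p y g i j 0 0 = sliceMass p y g j i 0 0 := by
  rw [sliceMass, sliceMass, slice_comm]

/-- The Laplace limits on the cells are symmetric, and positive across interfaces of positive
mass. -/
lemma exists_isLaplaceLimit_powerCell [IsFiniteMeasure μ] (hμ : IsRegularSource μ p)
    (hy : Function.Injective y) (hreg : IsContinuousAlongHyperplanes p y g) :
    ∃ r : Fin n → Fin n → ℝ, (∀ i j, 0 ≤ r i j) ∧ (∀ i j, i ≠ j → r i j = r j i) ∧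
      (∀ i j, i ≠ j → sliceMass p y g i j 0 0 ≠ 0 → 0 < r i j) ∧
      ∀ i j, i ≠ j → IsLaplaceLimit μ (powerCell y g i) (slack y g i j) (r i j) := by
  have hpair : ∀ i j, i ≠ j → ∃ r : ℝ, 0 ≤ r ∧ (sliceMass p y g i j 0 0 ≠ 0 → 0 < r) ∧
      IsLaplaceLimit μ (powerCell y g i) (slack y g i j) r ∧
      IsLaplaceLimit μ (powerCell y g j) (slack y g j i) r := by
    intro i j hij
    obtain ⟨c, hc0, hc, hmap⟩ := exists_map_slack_restrict_cell (g := g) hμ hy hij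
    obtain ⟨⟨hm1, hm2⟩, hm3, hm4⟩ := hmap 0
    refine ⟨(c * sliceMass p y g i j 0 0).toReal, ENNReal.toReal_nonneg, fun h =>
      ENNReal.toReal_pos (mul_ne_zero hc0 h) (ENNReal.mul_ne_top hc (hreg.finite i j hij)), ?_, ?_⟩
    · have := isLaplaceLimit_cell le_rfl hc hm1 hm2 (hreg.finite i j hij)
        ((hreg.continuous_slice i j hij).self_of_nhdsWithin self_mem_Ici)
      rwa [cell_zero] at this
    · have := isLaplaceLimit_cell le_rfl hc hm3 hm4 (hreg.finite j i hij.symm)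
        ((hreg.continuous_slice j i hij.symm).self_of_nhdsWithin self_mem_Ici)
      rwa [cell_zero, ← sliceMass_comm] at this
  choose! r h1 h2 h3 h4 using hpair
  refine ⟨fun i j => if i = j then 0 else r i j, fun i j => ?_, fun i j hij => ?_,
    fun i j hij => ?_, fun i j hij => ?_⟩
  · simp only
    split_ifs with h
    exacts [le_rfl, h1 i j h]
  · simp only [if_neg hij, if_neg hij.symm]
    exact (h3 i j hij).unique (h4 j i hij.symm)
  · simpa only [if_neg hij] using h2 i j hij
  · simpa only [if_neg hij] using h3 i j hij

lemma integrable_of_abs_le {X : Type*} [MeasurableSpace X] {m : Measure X} [IsFiniteMeasure m]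
    {F : X → ℝ} (hF : Measurable F) {S : Set X} (hS : MeasurableSet S) (C : ℝ)
    (hC : ∀ x ∈ S, |F x| ≤ C) : IntegrableOn F S m :=
  Measure.integrableOn_of_bounded (M := C) (measure_ne_top _ _) hF.aestronglyMeasurable
    ((ae_restrict_iff' hS).2 (Eventually.of_forall hC))

/-- Points close to two other cells do not contribute at order `1 / η`. -/
lemma tendsto_integral_powerCell_triple [IsProbabilityMeasure μ] (hμ : IsRegularSource μ p)
    (hy : Function.Injective y) (hreg : IsContinuousAlongHyperplanes p y g) {i j k : Fin n}
    (hij : i ≠ j) (hki : k ≠ i) (hkj : k ≠ j) {η : ℕ → ℝ} (hη : Tendsto η atTop atTop) :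
    Tendsto (fun m => η m * ∫ x in powerCell y g i,
      Real.exp (-(η m * slack y g i j x)) * Real.exp (-(η m * slack y g i k x)) ∂μ)
      atTop (𝓝 0) := by
  obtain ⟨c, -, hc, hmap⟩ := exists_map_slack_restrict_cell (g := g) hμ hy hij
  have hh0 := hreg.finite i j hij
  have hmono : ∀ a, 0 ≤ a → sliceMass p y g i j 0 a ≤ sliceMass p y g i j 0 0 := fun a ha =>
    lintegral_mono_set fun x hx => ⟨by rw [cell_zero]; exact cell_subset_powerCell ha hx.1, hx.2⟩
  have hlim : ∀ᶠ a in 𝓝[≥] (0 : ℝ), Tendsto (fun m => η m * ∫ x in cell y g i j a,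
      Real.exp (-(η m * slack y g i j x)) ∂μ) atTop
      (𝓝 (c * sliceMass p y g i j 0 a).toReal) := by
    filter_upwards [hreg.continuous_slice i j hij, self_mem_nhdsWithin] with a ha ha0
    have h := isLaplaceLimit_cell (μ := μ) ha0 hc (hmap a).1.1 (hmap a).1.2
      (ne_top_of_le_ne_top hh0 (hmono a ha0)) ha η (fun _ s => Real.exp (-s))
      (fun s => Real.exp (-s)) 1 hη (fun _ => by fun_prop)
      (Eventually.of_forall fun m s _ => by rw [abs_of_pos (Real.exp_pos _), one_mul])
      fun _ _ => tendsto_const_nhds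
    rwa [integral_exp_neg_Ioi_zero, mul_one] at h
  have hlim0 := hlim.self_of_nhdsWithin self_mem_Ici
  have hpush : Tendsto (fun a => (c * sliceMass p y g i j 0 a).toReal) (𝓝[≥] 0)
      (𝓝 (c * sliceMass p y g i j 0 0).toReal) :=
    (ENNReal.tendsto_toReal (ENNReal.mul_ne_top hc hh0)).comp
      (ENNReal.Tendsto.const_mul (hreg.continuous_push i j hij) (Or.inr hc))
  have hηpos := hη.eventually_gt_atTop 0
  -- Choose `a > 0` so that passing from the power cell to `cell y g i j a` loses less than `ε` in
  -- the Laplace limit of `e^{-ηΔᵢⱼ}`. On the removed part the second factor is bounded by one; on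
  -- the smaller cell `Δᵢₖ ≥ a` gives the negligible bound `η e^{-ηa}`.
  refine Metric.tendsto_nhds.2 fun ε hε => ?_
  have hsmall : ∀ᶠ a in 𝓝[>] (0 : ℝ), (c * sliceMass p y g i j 0 0).toReal -
      (c * sliceMass p y g i j 0 a).toReal < ε := by
    have h1 : Tendsto (fun a => (c * sliceMass p y g i j 0 0).toReal -
        (c * sliceMass p y g i j 0 a).toReal) (𝓝[≥] 0) (𝓝 0) := by
      simpa using hpush.const_sub (c * sliceMass p y g i j 0 0).toReal
    exact (h1.eventually (gt_mem_nhds hε)).filter_mono (nhdsWithin_mono _ Ioi_subset_Ici_self)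
  obtain ⟨a, haε, halim, ha⟩ := (hsmall.and ((hlim.filter_mono
    (nhdsWithin_mono _ Ioi_subset_Ici_self)).and self_mem_nhdsWithin)).exists
  have hbound := ((hlim0.sub halim).add (tendsto_mul_exp_neg_mul hη ha)).eventually
    (gt_mem_nhds (show _ < ε by rw [add_zero]; exact haε))
  filter_upwards [hbound, hηpos] with m hm hpos
  have hcm := (isClosed_cell (y := y) (g := g) i j a).measurableSet
  have hpm := (isClosed_powerCell (y := y) (g := g) i).measurableSet
  have hsub := cell_subset_powerCell (y := y) (g := g) (i := i) (j := j) ha.le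
  have hle1 : ∀ l, ∀ x ∈ powerCell y g i, Real.exp (-(η m * slack y g i l x)) ≤ 1 :=
    fun l x hx => Real.exp_le_one_iff.2 (neg_nonpos.2 (mul_nonneg hpos.le
      (mem_powerCell_iff.1 hx l)))
  have hm1 : ∀ l, Measurable fun x => Real.exp (-(η m * slack y g i l x)) := fun l => by
    have := (continuous_slack (y := y) (g := g) i l).measurable
    fun_prop
  have hi1 : IntegrableOn (fun x => Real.exp (-(η m * slack y g i j x))) (powerCell y g i) μ :=
    integrable_of_abs_le (hm1 j) hpm 1 fun x hx => by
      rw [abs_of_pos (Real.exp_pos _)]; exact hle1 j x hx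
  have hi2 : IntegrableOn (fun x => Real.exp (-(η m * slack y g i j x)) *
      Real.exp (-(η m * slack y g i k x))) (powerCell y g i) μ :=
    integrable_of_abs_le ((hm1 j).mul (hm1 k)) hpm 1 fun x hx => by
      rw [Pi.mul_apply, abs_of_pos (mul_pos (Real.exp_pos _) (Real.exp_pos _))]
      exact mul_le_one₀ (hle1 j x hx) (Real.exp_pos _).le (hle1 k x hx)
  have hnn : 0 ≤ ∫ x in powerCell y g i, Real.exp (-(η m * slack y g i j x)) *
      Real.exp (-(η m * slack y g i k x)) ∂μ := integral_nonneg fun x => by positivity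
  rw [Real.dist_eq, sub_zero, abs_of_nonneg (mul_nonneg hpos.le hnn)]
  refine lt_of_le_of_lt ?_ hm
  rw [cell_zero, ← mul_sub, ← mul_add]
  refine mul_le_mul_of_nonneg_left ?_ hpos.le
  have e1 := setIntegral_sdiff hcm hi1 hsub
  have e2 := setIntegral_sdiff hcm hi2 hsub
  have e3 : ∫ x in powerCell y g i \ cell y g i j a, Real.exp (-(η m * slack y g i j x)) *
      Real.exp (-(η m * slack y g i k x)) ∂μ ≤
      ∫ x in powerCell y g i \ cell y g i j a, Real.exp (-(η m * slack y g i j x)) ∂μ :=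
    setIntegral_mono_on (hi2.mono_set sdiff_subset) (hi1.mono_set sdiff_subset) (hpm.diff hcm)
      fun x hx => mul_le_of_le_one_right (Real.exp_pos _).le (hle1 k x hx.1)
  have e4 : ∫ x in cell y g i j a, Real.exp (-(η m * slack y g i j x)) *
      Real.exp (-(η m * slack y g i k x)) ∂μ ≤ Real.exp (-(η m * a)) := by
    have h1 : ∀ x ∈ cell y g i j a, Real.exp (-(η m * slack y g i j x)) *
        Real.exp (-(η m * slack y g i k x)) ≤ Real.exp (-(η m * a)) := fun x hx => by
      have h2 := mem_cell_iff.1 hx k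
      rw [if_pos ⟨hki, hkj⟩] at h2
      refine (mul_le_of_le_one_left (Real.exp_pos _).le (hle1 j x (hsub hx))).trans ?_
      gcongr
    refine (setIntegral_mono_on (hi2.mono_set hsub) (integrable_const _) hcm h1).trans ?_
    rw [setIntegral_const, smul_eq_mul]
    exact mul_le_of_le_one_left (Real.exp_pos _).le measureReal_le_one
  linarith

end CellAsymptotics

/-! ### Inequalities for sums of exponentials -/

section LogSum

variable {ι : Type*} [DecidableEq ι]

lemma log_one_add_sum_le (s : Finset ι) {a : ι → ℝ} (ha : ∀ k, 0 ≤ a k) :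
    Real.log (1 + ∑ k ∈ s, a k) ≤ ∑ k ∈ s, Real.log (1 + a k) := by
  induction s using Finset.induction_on with
  | empty => simp
  | insert j s hj ih =>
    rw [Finset.sum_insert hj, Finset.sum_insert hj]
    have hS : 0 ≤ ∑ k ∈ s, a k := Finset.sum_nonneg fun k _ => ha k
    have h1 : Real.log (1 + (a j + ∑ k ∈ s, a k)) ≤
        Real.log ((1 + a j) * (1 + ∑ k ∈ s, a k)) :=
      Real.log_le_log (by linarith [ha j]) (by nlinarith [mul_nonneg (ha j) hS])
    rw [Real.log_mul (by linarith [ha j]) (by linarith)] at h1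
    linarith

/-- Induction with `(1 + a)(1 + S) ≤ (1 + a + S)(1 + a S)` and `log (1 + a S) ≤ a S`: the error
consists of pair products only. -/
lemma sum_log_one_add_le (s : Finset ι) {a : ι → ℝ} (ha : ∀ k, 0 ≤ a k) :
    ∑ k ∈ s, Real.log (1 + a k) ≤
      Real.log (1 + ∑ k ∈ s, a k) + ∑ j ∈ s, ∑ k ∈ s.erase j, a j * a k := by
  induction s using Finset.induction_on with
  | empty => simp
  | insert i s hi ih =>
    rw [Finset.sum_insert hi, Finset.sum_insert hi, Finset.sum_insert hi, Finset.erase_insert hi]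
    have hS : 0 ≤ ∑ k ∈ s, a k := Finset.sum_nonneg fun k _ => ha k
    have hi0 := ha i
    have h1 : Real.log ((1 + a i) * (1 + ∑ k ∈ s, a k)) ≤
        Real.log ((1 + (a i + ∑ k ∈ s, a k)) * (1 + a i * ∑ k ∈ s, a k)) := by
      refine Real.log_le_log (by positivity) ?_
      nlinarith [mul_nonneg (add_nonneg hi0 hS) (mul_nonneg hi0 hS)]
    have h2 : Real.log (1 + a i * ∑ k ∈ s, a k) ≤ a i * ∑ k ∈ s, a k := by
      have := Real.log_le_sub_one_of_pos (show 0 < 1 + a i * ∑ k ∈ s, a k by positivity)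
      linarith
    rw [Real.log_mul (by positivity) (by positivity), Real.log_mul (by positivity) (by positivity)]
      at h1
    have h3 : ∑ j ∈ s, ∑ k ∈ s.erase j, a j * a k ≤
        ∑ j ∈ s, ∑ k ∈ (insert i s).erase j, a j * a k :=
      Finset.sum_le_sum fun j _ => Finset.sum_le_sum_of_subset_of_nonneg
        (Finset.erase_subset_erase _ (Finset.subset_insert _ _))
        fun k _ _ => mul_nonneg (ha j) (ha k)
    rw [← Finset.mul_sum]
    linarith

/-- Applied with `b k = e^{-ηΔᵢₖ}`, this decouples the neighbours of cell `i`. The factor `e⁴` comes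
from `(v j - v i) + (v k - v i) ≤ 4`. -/
lemma le_log_sum_mul_exp_sub [Fintype ι] {b v : ι → ℝ} (hb : ∀ k, 0 ≤ b k) {i : ι}
    (hbi : b i = 1) (hv : ∀ k, |v k| ≤ 1) :
    v i + ∑ k ∈ Finset.univ.erase i, (Real.log (1 + Real.exp (v k - v i) * b k) -
      Real.log (1 + b k)) - Real.exp 4 * ∑ j ∈ Finset.univ.erase i,
        ∑ k ∈ (Finset.univ.erase i).erase j, b j * b k ≤
      Real.log (∑ k, b k * Real.exp (v k)) - Real.log (∑ k, b k) := by
  set s := Finset.univ.erase i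
  have ha : ∀ k, 0 ≤ Real.exp (v k - v i) * b k := fun k => mul_nonneg (Real.exp_pos _).le (hb k)
  have e1 : ∑ k, b k * Real.exp (v k) =
      Real.exp (v i) * (1 + ∑ k ∈ s, Real.exp (v k - v i) * b k) := by
    rw [← Finset.add_sum_erase _ _ (Finset.mem_univ i), hbi, mul_add, Finset.mul_sum, one_mul,
      mul_one]
    congr 1
    refine Finset.sum_congr rfl fun k _ => ?_
    rw [← mul_assoc, ← Real.exp_add, mul_comm]
    congr 2
    ring
  have e2 : ∑ k, b k = 1 + ∑ k ∈ s, b k := by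
    rw [← Finset.add_sum_erase _ _ (Finset.mem_univ i), hbi]
  have hS : 0 ≤ ∑ k ∈ s, Real.exp (v k - v i) * b k := Finset.sum_nonneg fun k _ => ha k
  rw [e1, e2, Real.log_mul (Real.exp_pos _).ne' (by positivity), Real.log_exp]
  have h1 := log_one_add_sum_le s hb
  have h2 := sum_log_one_add_le s ha
  have h3 : ∑ j ∈ s, ∑ k ∈ s.erase j,
      (Real.exp (v j - v i) * b j) * (Real.exp (v k - v i) * b k) ≤
      Real.exp 4 * ∑ j ∈ s, ∑ k ∈ s.erase j, b j * b k := by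
    simp_rw [Finset.mul_sum]
    refine Finset.sum_le_sum fun j _ => Finset.sum_le_sum fun k _ => ?_
    have h4 : Real.exp (v j - v i) * Real.exp (v k - v i) ≤ Real.exp 4 := by
      rw [← Real.exp_add, Real.exp_le_exp]
      have := abs_le.1 (hv i); have := abs_le.1 (hv j); have := abs_le.1 (hv k)
      linarith
    calc _ = (Real.exp (v j - v i) * Real.exp (v k - v i)) * (b j * b k) := by ring
      _ ≤ _ := mul_le_mul_of_nonneg_right h4 (mul_nonneg (hb j) (hb k))
  rw [Finset.sum_sub_distrib]
  linarith

end LogSum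

/-! ### The two-cell profile -/

/-- The second difference profile `log (1 + e^{u - s}) - log (1 + e^{-s})` at an interface. -/
def profile (u s : ℝ) : ℝ :=
  Real.log (1 + Real.exp u * Real.exp (-s)) - Real.log (1 + Real.exp (-s))

lemma continuous_profile : Continuous fun q : ℝ × ℝ => profile q.1 q.2 := by
  unfold profile
  refine Continuous.sub ?_ ?_ <;> exact Continuous.log (by fun_prop) fun q => by positivity

lemma abs_profile_le {u : ℝ} (hu : |u| ≤ 2) (s : ℝ) :
    |profile u s| ≤ Real.exp 2 * Real.exp (-s) := by
  have hlog : ∀ x : ℝ, 0 ≤ x → 0 ≤ Real.log (1 + x) ∧ Real.log (1 + x) ≤ x := fun x hx =>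
    ⟨Real.log_nonneg (by linarith), by
      have := Real.log_le_sub_one_of_pos (show 0 < 1 + x by linarith); linarith⟩
  have h1 := hlog (Real.exp u * Real.exp (-s)) (by positivity)
  have h2 := hlog (Real.exp (-s)) (by positivity)
  have h3 : Real.exp u * Real.exp (-s) ≤ Real.exp 2 * Real.exp (-s) := by
    gcongr; exact (abs_le.1 hu).2
  have h4 : 1 * Real.exp (-s) ≤ Real.exp 2 * Real.exp (-s) := by
    gcongr; exact Real.one_le_exp (by norm_num)
  rw [profile, abs_le]
  constructor <;> linarith

lemma integrableOn_profile {u : ℝ} (hu : |u| ≤ 2) : IntegrableOn (profile u) (Ioi 0) := by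
  refine Integrable.mono' ((integrableOn_exp_neg_Ioi 0).const_mul (Real.exp 2)) ?_
    (Eventually.of_forall fun s => abs_profile_le hu s)
  exact (continuous_profile.comp
    (by fun_prop : Continuous fun s : ℝ => (u, s))).aestronglyMeasurable

/-- Since `e^u + e^{-u} > 2`, with `E = e^{-s}` one has `(1 + e^u E)(1 + e^{-u} E) > (1 + E)²`; take
logarithms. -/
lemma profile_add_profile_neg_pos {u : ℝ} (hu : u ≠ 0) (s : ℝ) :
    0 < profile u s + profile (-u) s := by
  have hE := Real.exp_pos (-s)
  have hu1 := Real.exp_pos u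
  have hu2 := Real.exp_pos (-u)
  have hprod : Real.exp u * Real.exp (-u) = 1 := by rw [← Real.exp_add]; simp
  have hne : Real.exp u ≠ Real.exp (-u) := fun h => hu (by
    have := Real.exp_injective h; linarith)
  have hsum : 2 < Real.exp u + Real.exp (-u) := by
    nlinarith [mul_self_pos.2 (sub_ne_zero.2 hne)]
  have h : Real.log ((1 + Real.exp (-s)) * (1 + Real.exp (-s))) <
      Real.log ((1 + Real.exp u * Real.exp (-s)) * (1 + Real.exp (-u) * Real.exp (-s))) := by
    refine Real.log_lt_log (by positivity) ?_
    have : (1 + Real.exp u * Real.exp (-s)) * (1 + Real.exp (-u) * Real.exp (-s)) =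
        1 + (Real.exp u + Real.exp (-u)) * Real.exp (-s) + Real.exp (-s) * Real.exp (-s) := by
      linear_combination Real.exp (-s) * Real.exp (-s) * hprod
    rw [this]
    nlinarith
  rw [Real.log_mul (by positivity) (by positivity), Real.log_mul (by positivity) (by positivity)]
    at h
  unfold profile
  linarith

lemma integral_profile_add_pos {u : ℝ} (hu : |u| ≤ 2) (hu0 : u ≠ 0) :
    0 < (∫ s in Ioi 0, profile u s) + ∫ s in Ioi 0, profile (-u) s := by
  have hi1 := integrableOn_profile hu
  have hi2 := integrableOn_profile (u := -u) (by rwa [abs_neg])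
  rw [← integral_add hi1 hi2]
  have hpos := profile_add_profile_neg_pos hu0
  refine (integral_pos_iff_support_of_nonneg (fun s => (hpos s).le) (hi1.add hi2)).2 ?_
  have : Function.support (fun s => profile u s + profile (-u) s) = univ :=
    eq_univ_of_forall fun s => (hpos s).ne'
  rw [this]
  simp

/-! ### Convergence of the rescaled weights -/

section Convergence

variable {d n : ℕ} {μ ν : Measure (EuclideanSpace ℝ (Fin d))}
  {p : EuclideanSpace ℝ (Fin d) → ℝ≥0} {y : Fin n → EuclideanSpace ℝ (Fin d)}
  {g : EuclideanSpace ℝ (Fin d) → ℝ}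

/-- The entropic `c`-transform is concave in the weights. -/
lemma softMin_concave [NeZero n] {η : ℝ} (hη : 0 < η) (a b : Fin n → ℝ) {θ : ℝ} (h0 : 0 ≤ θ)
    (h1 : θ ≤ 1) (x : EuclideanSpace ℝ (Fin d)) :
    (1 - θ) * softMin y η a x + θ * softMin y η b x ≤
      softMin y η (fun k => (1 - θ) * a k + θ * b k) x := by
  set A := Real.log (gibbsSum y η a x)
  set B := Real.log (gibbsSum y η b x)
  -- Normalized by their partition functions, both families of exponentials sum to one. Convexity of
  -- `exp` in each summand then yields Hölder's inequality for the mixed partition function.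
  have hA : ∑ k, Real.exp (-η * (‖x - y k‖ ^ 2 - a k) - A) = 1 := by
    simp_rw [Real.exp_sub, ← Finset.sum_div]
    rw [Real.exp_log (gibbsSum_pos η a x)]
    exact div_self (gibbsSum_pos η a x).ne'
  have hB : ∑ k, Real.exp (-η * (‖x - y k‖ ^ 2 - b k) - B) = 1 := by
    simp_rw [Real.exp_sub, ← Finset.sum_div]
    rw [Real.exp_log (gibbsSum_pos η b x)]
    exact div_self (gibbsSum_pos η b x).ne'
  have hle : gibbsSum y η (fun k => (1 - θ) * a k + θ * b k) x ≤
      Real.exp ((1 - θ) * A + θ * B) := by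
    have h : ∑ k, Real.exp ((1 - θ) * (-η * (‖x - y k‖ ^ 2 - a k) - A) +
        θ * (-η * (‖x - y k‖ ^ 2 - b k) - B)) ≤ 1 := by
      calc _ ≤ ∑ k, ((1 - θ) * Real.exp (-η * (‖x - y k‖ ^ 2 - a k) - A) +
            θ * Real.exp (-η * (‖x - y k‖ ^ 2 - b k) - B)) :=
            Finset.sum_le_sum fun k _ => convexOn_exp.2 (mem_univ _) (mem_univ _)
              (sub_nonneg.2 h1) h0 (by ring)
        _ = 1 := by
            rw [Finset.sum_add_distrib, ← Finset.mul_sum, ← Finset.mul_sum, hA, hB]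
            ring
    have e : gibbsSum y η (fun k => (1 - θ) * a k + θ * b k) x =
        Real.exp ((1 - θ) * A + θ * B) * ∑ k, Real.exp
          ((1 - θ) * (-η * (‖x - y k‖ ^ 2 - a k) - A) +
            θ * (-η * (‖x - y k‖ ^ 2 - b k) - B)) := by
      rw [gibbsSum, Finset.mul_sum]
      refine Finset.sum_congr rfl fun k _ => ?_
      rw [← Real.exp_add]
      congr 1
      ring
    rw [e]
    exact mul_le_of_le_one_right (Real.exp_pos _).le h
  have hlog := Real.log_le_log (gibbsSum_pos η _ x) hle
  rw [Real.log_exp] at hlog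
  have := mul_le_mul_of_nonneg_left hlog (one_div_pos.2 hη).le
  simp only [softMin]
  linarith

lemma gibbsSum_eq_mul {η : ℝ} (hη : 0 < η) (v : Fin n → ℝ) (i : Fin n)
    (x : EuclideanSpace ℝ (Fin d)) :
    gibbsSum y η (fun k => g (y k) + η⁻¹ * v k) x =
      Real.exp (-η * (‖x - y i‖ ^ 2 - g (y i))) *
        ∑ k, Real.exp (-(η * slack y g i k x)) * Real.exp (v k) := by
  rw [gibbsSum, Finset.mul_sum]
  refine Finset.sum_congr rfl fun k _ => ?_
  rw [← Real.exp_add, ← Real.exp_add]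
  congr 1
  simp only [slack]
  field_simp
  ring

lemma log_gibbsSum_eq {η : ℝ} (hη : 0 < η) (v : Fin n → ℝ) (i : Fin n)
    (x : EuclideanSpace ℝ (Fin d)) :
    Real.log (gibbsSum y η (fun k => g (y k) + η⁻¹ * v k) x) =
      -η * (‖x - y i‖ ^ 2 - g (y i)) +
        Real.log (∑ k, Real.exp (-(η * slack y g i k x)) * Real.exp (v k)) := by
  have : 0 < ∑ k, Real.exp (-(η * slack y g i k x)) * Real.exp (v k) :=
    Finset.sum_pos (fun k _ => by positivity) ⟨i, Finset.mem_univ _⟩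
  rw [gibbsSum_eq_mul hη v i, Real.log_mul (Real.exp_pos _).ne' this.ne', Real.log_exp]

lemma mul_softMin_sub {η : ℝ} (hη : 0 < η) (v : Fin n → ℝ) (i : Fin n)
    (x : EuclideanSpace ℝ (Fin d)) :
    η * (softMin y η (g ∘ y) x - softMin y η (fun k => g (y k) + η⁻¹ * v k) x) =
      Real.log (∑ k, Real.exp (-(η * slack y g i k x)) * Real.exp (v k)) -
        Real.log (∑ k, Real.exp (-(η * slack y g i k x))) := by
  have h0 := log_gibbsSum_eq (y := y) (g := g) hη 0 i x
  simp only [Pi.zero_apply, mul_zero, add_zero, Real.exp_zero, mul_one] at h0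
  simp only [softMin]
  rw [log_gibbsSum_eq hη v i, show (g ∘ y) = fun k => g (y k) from rfl, h0]
  field_simp
  ring

/-- The first-order expansion of the semi-dual functional at the unregularized weights. -/
lemma sum_integral_profile_le [NeZero n] [IsProbabilityMeasure μ] (hac : μ ≪ volume)
    (hy : Function.Injective y) (h2 : Integrable (fun x => ‖x‖ ^ 2) μ) {η : ℝ} (hη : 0 < η)
    {v : Fin n → ℝ} (hv : ∀ k, |v k| ≤ 1) (hv0 : ∑ i, μ.real (powerCell y g i) * v i = 0)
    (hle : ∫ x, softMin y η (g ∘ y) x ∂μ ≤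
      ∫ x, softMin y η (fun k => g (y k) + η⁻¹ * v k) x ∂μ) :
    ∑ i, ∑ k ∈ Finset.univ.erase i,
        η * ∫ x in powerCell y g i, profile (v k - v i) (η * slack y g i k x) ∂μ ≤
      Real.exp 4 * ∑ i, ∑ j ∈ Finset.univ.erase i, ∑ k ∈ (Finset.univ.erase i).erase j,
        η * ∫ x in powerCell y g i,
          Real.exp (-(η * slack y g i j x)) * Real.exp (-(η * slack y g i k x)) ∂μ := by
  set F : EuclideanSpace ℝ (Fin d) → ℝ := fun x =>
    η * (softMin y η (g ∘ y) x - softMin y η (fun k => g (y k) + η⁻¹ * v k) x) with hF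
  have hi1 : Integrable (softMin y η (g ∘ y)) μ := integrable_softMin h2 hη _
  have hi2 : Integrable (softMin y η (fun k => g (y k) + η⁻¹ * v k)) μ :=
    integrable_softMin h2 hη _
  have hFi : Integrable F μ := (hi1.sub hi2).const_mul η
  have hF0 : ∫ x, F x ∂μ ≤ 0 := by
    rw [hF, integral_const_mul, integral_sub hi1 hi2]
    exact mul_nonpos_of_nonneg_of_nonpos hη.le (by linarith)
  -- Integrate the pointwise decoupling over one cell. After summation over cells the terms `μ.real
  -- (powerCell y g i) * v i` cancel by `hv0`.
  have hcell : ∀ i, μ.real (powerCell y g i) * v i +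
      ∑ k ∈ Finset.univ.erase i,
        ∫ x in powerCell y g i, profile (v k - v i) (η * slack y g i k x) ∂μ -
      Real.exp 4 * ∑ j ∈ Finset.univ.erase i, ∑ k ∈ (Finset.univ.erase i).erase j,
        ∫ x in powerCell y g i,
          Real.exp (-(η * slack y g i j x)) * Real.exp (-(η * slack y g i k x)) ∂μ ≤
      ∫ x in powerCell y g i, F x ∂μ := by
    intro i
    have hpm := (isClosed_powerCell (y := y) (g := g) i).measurableSet
    have hsl : ∀ k, ∀ x ∈ powerCell y g i, Real.exp (-(η * slack y g i k x)) ≤ 1 :=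
      fun k x hx => Real.exp_le_one_iff.2 (neg_nonpos.2 (mul_nonneg hη.le
        (mem_powerCell_iff.1 hx k)))
    have hsm : ∀ k, Measurable (slack y g i k) := fun k => (continuous_slack i k).measurable
    have hp : ∀ k, IntegrableOn (fun x => profile (v k - v i) (η * slack y g i k x))
        (powerCell y g i) μ := fun k => by
      refine integrable_of_abs_le ?_ hpm (Real.exp 2) fun x hx => ?_
      · have := (continuous_profile.comp (by fun_prop :
          Continuous fun s : ℝ => (v k - v i, s))).measurable
        exact this.comp ((hsm k).const_mul η)
      · refine (abs_profile_le ?_ _).trans (mul_le_of_le_one_right (Real.exp_pos _).le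
          (hsl k x hx))
        have := abs_le.1 (hv i); have := abs_le.1 (hv k)
        rw [abs_le]; constructor <;> linarith
    have he : ∀ j k, IntegrableOn (fun x => Real.exp (-(η * slack y g i j x)) *
        Real.exp (-(η * slack y g i k x))) (powerCell y g i) μ := fun j k => by
      refine integrable_of_abs_le (by have := hsm j; have := hsm k; fun_prop) hpm 1 fun x hx => ?_
      rw [abs_of_pos (by positivity)]
      exact mul_le_one₀ (hsl j x hx) (Real.exp_pos _).le (hsl k x hx)
    have hps : IntegrableOn (fun x => ∑ k ∈ Finset.univ.erase i,
        profile (v k - v i) (η * slack y g i k x)) (powerCell y g i) μ :=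
      integrable_finsetSum _ fun k _ => hp k
    have hcp : IntegrableOn (fun x => v i + ∑ k ∈ Finset.univ.erase i,
        profile (v k - v i) (η * slack y g i k x)) (powerCell y g i) μ :=
      (integrable_const _).add hps
    have hes : IntegrableOn (fun x => ∑ j ∈ Finset.univ.erase i,
        ∑ k ∈ (Finset.univ.erase i).erase j, Real.exp (-(η * slack y g i j x)) *
          Real.exp (-(η * slack y g i k x))) (powerCell y g i) μ :=
      integrable_finsetSum _ fun j _ => integrable_finsetSum _ fun k _ => he j k
    have e1 : ∫ x in powerCell y g i, ((v i + ∑ k ∈ Finset.univ.erase i,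
        profile (v k - v i) (η * slack y g i k x)) - Real.exp 4 * ∑ j ∈ Finset.univ.erase i,
        ∑ k ∈ (Finset.univ.erase i).erase j, Real.exp (-(η * slack y g i j x)) *
          Real.exp (-(η * slack y g i k x))) ∂μ = μ.real (powerCell y g i) * v i +
      ∑ k ∈ Finset.univ.erase i,
        ∫ x in powerCell y g i, profile (v k - v i) (η * slack y g i k x) ∂μ -
      Real.exp 4 * ∑ j ∈ Finset.univ.erase i, ∑ k ∈ (Finset.univ.erase i).erase j,
        ∫ x in powerCell y g i,
          Real.exp (-(η * slack y g i j x)) * Real.exp (-(η * slack y g i k x)) ∂μ := by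
      rw [integral_sub hcp (hes.const_mul _),
        integral_add (integrable_const _) hps, integral_const_mul,
        integral_finsetSum _ fun k _ => hp k,
        integral_finsetSum _ fun j _ => integrable_finsetSum _ fun k _ => he j k,
        setIntegral_const, smul_eq_mul]
      congr 2
      exact Finset.sum_congr rfl fun j _ => integral_finsetSum _ fun k _ => he j k
    rw [← e1]
    refine setIntegral_mono_on (hcp.sub (hes.const_mul _))
      hFi.integrableOn hpm fun x hx => ?_
    rw [hF]
    simp only
    rw [mul_softMin_sub hη v i x]
    exact le_log_sum_mul_exp_sub (fun k => (Real.exp_pos _).le) (by rw [slack_self]; simp) hv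
  rw [integral_eq_sum_powerCell hy hac hFi] at hF0
  have hsum := (Finset.sum_le_sum fun i (_ : i ∈ Finset.univ) => hcell i).trans hF0
  rw [Finset.sum_sub_distrib, Finset.sum_add_distrib, hv0, ← Finset.mul_sum] at hsum
  have := mul_le_mul_of_nonneg_left hsum hη.le
  simp_rw [← Finset.mul_sum]
  linarith

/-- Limits of rescaled weights along which the semi-dual functional does not decrease vanish. -/
lemma limit_weights_eq_zero [NeZero n] [IsProbabilityMeasure μ] (hμ : IsRegularSource μ p)
    (hy : Function.Injective y) (hpos : ∀ i, μ (powerCell y g i) ≠ 0)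
    (hreg : IsContinuousAlongHyperplanes p y g) {η : ℕ → ℝ} (hη : Tendsto η atTop atTop)
    {v : ℕ → Fin n → ℝ} {w : Fin n → ℝ} (hvw : Tendsto v atTop (𝓝 w))
    (hv : ∀ m k, |v m k| ≤ 1) (hv0 : ∀ m, ∑ i, μ.real (powerCell y g i) * v m i = 0)
    (hle : ∀ᶠ m in atTop, ∫ x, softMin y (η m) (g ∘ y) x ∂μ ≤
      ∫ x, softMin y (η m) (fun k => g (y k) + (η m)⁻¹ * v m k) x ∂μ) : w = 0 := by
  obtain ⟨r, hr0, hrs, hrpos, hr⟩ := exists_isLaplaceLimit_powerCell hμ hy hreg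
  have hvk : ∀ k, Tendsto (fun m => v m k) atTop (𝓝 (w k)) := fun k =>
    tendsto_pi_nhds.1 hvw k
  have hw : ∀ k, |w k| ≤ 1 := fun k =>
    le_of_tendsto' (hvk k).abs fun m => hv m k
  have hdiff : ∀ {u : Fin n → ℝ}, (∀ k, |u k| ≤ 1) → ∀ i k, |u k - u i| ≤ 2 := fun hu i k => by
    have := abs_le.1 (hu i); have := abs_le.1 (hu k)
    rw [abs_le]; constructor <;> linarith
  let Φ : ℝ → ℝ := fun u => ∫ s in Ioi 0, profile u s
  have hlhs : Tendsto (fun m => ∑ i, ∑ k ∈ Finset.univ.erase i, η m *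
      ∫ x in powerCell y g i, profile (v m k - v m i) (η m * slack y g i k x) ∂μ) atTop
      (𝓝 (∑ i, ∑ k ∈ Finset.univ.erase i, r i k * Φ (w k - w i))) := by
    refine tendsto_finsetSum _ fun i _ => tendsto_finsetSum _ fun k hk => ?_
    refine hr i k (Finset.ne_of_mem_erase hk).symm η (fun m => profile (v m k - v m i))
      (profile (w k - w i)) (Real.exp 2) hη (fun m => ?_) (Eventually.of_forall fun m s _ =>
        abs_profile_le (hdiff (hv m) i k) s) fun s _ => ?_
    · exact (continuous_profile.comp (by fun_prop :
        Continuous fun s : ℝ => (v m k - v m i, s))).measurable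
    · have h1 := (continuous_profile.tendsto (w k - w i, s)).comp
        (((hvk k).sub (hvk i)).prodMk_nhds tendsto_const_nhds)
      exact h1
  have hrhs : Tendsto (fun m => Real.exp 4 * ∑ i, ∑ j ∈ Finset.univ.erase i,
      ∑ k ∈ (Finset.univ.erase i).erase j, η m * ∫ x in powerCell y g i,
        Real.exp (-(η m * slack y g i j x)) * Real.exp (-(η m * slack y g i k x)) ∂μ) atTop
      (𝓝 (Real.exp 4 * ∑ i : Fin n, ∑ j ∈ Finset.univ.erase i,
        ∑ k ∈ (Finset.univ.erase i).erase j, (0 : ℝ))) := by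
    refine Tendsto.const_mul _ (tendsto_finsetSum _ fun i _ => tendsto_finsetSum _ fun j hj =>
      tendsto_finsetSum _ fun k hk => ?_)
    have hk' := Finset.mem_erase.1 hk
    exact tendsto_integral_powerCell_triple hμ hy hreg (Finset.ne_of_mem_erase hj).symm
      (Finset.ne_of_mem_erase hk'.2) hk'.1 hη
  have hlim : ∑ i, ∑ k ∈ Finset.univ.erase i, r i k * Φ (w k - w i) ≤ 0 := by
    have h := le_of_tendsto_of_tendsto hlhs hrhs ?_
    · simpa using h
    · filter_upwards [hle, hη.eventually_gt_atTop 0] with m hm hpos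
      exact sum_integral_profile_le hμ.absolutelyContinuous hy hμ.second_moment hpos (hv m)
        (hv0 m) hm
  have hΦ0 : Φ 0 = 0 := by simp [Φ, profile]
  have hΦ : ∀ i k, 0 ≤ Φ (w k - w i) + Φ (w i - w k) ∧
      (w k ≠ w i → 0 < Φ (w k - w i) + Φ (w i - w k)) := fun i k => by
    have hp : w k ≠ w i → 0 < Φ (w k - w i) + Φ (w i - w k) := fun h => by
      have := integral_profile_add_pos (hdiff hw i k) (sub_ne_zero.2 h)
      rwa [neg_sub] at this
    refine ⟨?_, hp⟩
    by_cases h : w k = w i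
    · simp [h, hΦ0]
    · exact (hp h).le
  have hfull : ∑ i, ∑ k, r i k * Φ (w k - w i) ≤ 0 := by
    refine le_of_eq_of_le (Finset.sum_congr rfl fun i _ => ?_) hlim
    rw [← Finset.add_sum_erase _ _ (Finset.mem_univ i), sub_self, hΦ0, mul_zero, zero_add]
  -- Only the sum `Φ u + Φ (-u)` has a known sign, so the inequality is symmetrized using `r i k = r
  -- k i`.
  have hsymm : ∑ i, ∑ k, r i k * (Φ (w k - w i) + Φ (w i - w k)) ≤ 0 := by
    have hswap : ∑ i, ∑ k, r i k * Φ (w i - w k) = ∑ i, ∑ k, r i k * Φ (w k - w i) := by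
      rw [Finset.sum_comm]
      refine Finset.sum_congr rfl fun i _ => Finset.sum_congr rfl fun k _ => ?_
      by_cases h : i = k
      · rw [h]
      · rw [hrs i k h]
    simp_rw [mul_add, Finset.sum_add_distrib]
    rw [hswap]
    linarith
  have hterm : ∀ i k, 0 ≤ r i k * (Φ (w k - w i) + Φ (w i - w k)) := fun i k =>
    mul_nonneg (hr0 i k) (hΦ i k).1
  -- Otherwise an interface of positive mass separates the indices with weight `w 0` from the
  -- others, and its term makes the symmetrized sum positive.
  have hconst : ∀ k, w k = w 0 := by
    by_contra! hne
    obtain ⟨k', hk'⟩ := hne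
    obtain ⟨k, hk, l, hl, hkl⟩ := exists_sliceMass_ne_zero (A := {k | w k = w 0}) hμ hy hpos
      ⟨0, rfl⟩ ⟨k', hk'⟩
    have hne : k ≠ l := fun h => hl (h ▸ hk)
    have hw' : w l ≠ w k := fun h => hl (h.trans hk)
    have h1 := mul_pos (hrpos k l hne hkl) ((hΦ k l).2 hw')
    have h3 : 0 < ∑ i, ∑ k, r i k * (Φ (w k - w i) + Φ (w i - w k)) :=
      Finset.sum_pos' (fun i _ => Finset.sum_nonneg fun k _ => hterm i k)
        ⟨k, Finset.mem_univ _, Finset.sum_pos' (fun k' _ => hterm k k') ⟨l, Finset.mem_univ _, h1⟩⟩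
    linarith
  have hw0 : ∑ i, μ.real (powerCell y g i) * w i = 0 := by
    refine tendsto_nhds_unique (f := fun m => ∑ i, μ.real (powerCell y g i) * v m i)
      (tendsto_finsetSum _ fun i _ => (hvk i).const_mul _) ?_
    simp_rw [hv0]
    exact tendsto_const_nhds
  have hmass : ∑ i, μ.real (powerCell y g i) = 1 := by
    have := sum_measure_powerCell (g := g) hy hμ.absolutelyContinuous
    simp_rw [measureReal_def]
    rw [← ENNReal.toReal_sum fun i _ => measure_ne_top _ _, this, measure_univ,
      ENNReal.toReal_one]
  simp_rw [hconst, ← Finset.sum_mul, hmass, one_mul] at hw0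
  funext k
  rw [hconst, hw0, Pi.zero_apply]

/-- The rescaled differences of the weights tend to zero. -/
lemma tendsto_weights [NeZero n] [IsProbabilityMeasure μ] (hμ : IsRegularSource μ p)
    (hy : Function.Injective y) (hpos : ∀ i, μ (powerCell y g i) ≠ 0)
    (hreg : IsContinuousAlongHyperplanes p y g) {a : ℝ → Fin n → ℝ}
    (ha0 : ∀ η, 0 < η → ∑ i, μ.real (powerCell y g i) * (a η i - g (y i)) = 0)
    (hle : ∀ η, 0 < η → ∫ x, softMin y η (g ∘ y) x ∂μ ≤ ∫ x, softMin y η (a η) x ∂μ) :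
    Tendsto (fun η k => η * (a η k - g (y k))) atTop (𝓝 (0 : Fin n → ℝ)) := by
  set u : ℝ → Fin n → ℝ := fun η k => η * (a η k - g (y k)) with hu
  -- The factor `θ` shrinks `u η` into the unit ball and equals one if `u η` is already there.
  let θ : ℝ → ℝ := fun η => (max 1 ‖u η‖)⁻¹
  have hmax : ∀ η, 0 < max 1 ‖u η‖ := fun η => lt_max_of_lt_left one_pos
  have hθ0 : ∀ η, 0 ≤ θ η := fun η => (inv_pos.2 (hmax η)).le
  have hθ1 : ∀ η, θ η ≤ 1 := fun η => inv_le_one_of_one_le₀ (le_max_left _ _)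
  have hnorm : ∀ η, ‖θ η • u η‖ ≤ 1 := fun η => by
    rw [norm_smul, Real.norm_of_nonneg (hθ0 η), inv_mul_le_one₀ (hmax η)]
    exact le_max_right _ _
  have hlim : Tendsto (fun η => θ η • u η) atTop (𝓝 0) := by
    refine tendsto_of_subseq_tendsto fun η hη => ?_
    -- Replacing `η m` by `max 1 (η m)` makes every parameter positive without changing the tail of
    -- the sequence.
    have hη' : Tendsto (fun m => max 1 (η m)) atTop atTop :=
      tendsto_atTop_mono (fun m => le_max_right _ _) hη
    obtain ⟨w, -, ms, hms, hw⟩ := (isCompact_closedBall (0 : Fin n → ℝ) 1).tendsto_subseq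
      (x := fun m => θ (max 1 (η m)) • u (max 1 (η m)))
      fun m => mem_closedBall_zero_iff.2 (hnorm _)
    refine ⟨ms, ?_⟩
    have hw0 : w = 0 := by
      refine limit_weights_eq_zero hμ hy hpos hreg (hη'.comp hms.tendsto_atTop) hw
        (fun m k => (norm_le_pi_norm (θ _ • u _) k).trans (hnorm _)) (fun m => ?_)
        (Eventually.of_forall fun m => ?_)
      · have h := ha0 (max 1 (η (ms m))) (lt_max_of_lt_left one_pos)
        simp only [Function.comp, Pi.smul_apply, smul_eq_mul, hu]
        calc _ = θ (max 1 (η (ms m))) * max 1 (η (ms m)) * ∑ i, μ.real (powerCell y g i) *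
              (a (max 1 (η (ms m))) i - g (y i)) := by
              rw [Finset.mul_sum]
              exact Finset.sum_congr rfl fun i _ => by ring
          _ = 0 := by rw [h, mul_zero]
      · simp only [Function.comp]
        set e := max 1 (η (ms m))
        have he : 0 < e := lt_max_of_lt_left one_pos
        have hi1 : Integrable (softMin y e (g ∘ y)) μ := integrable_softMin hμ.second_moment he _
        have hi2 : Integrable (softMin y e (a e)) μ := integrable_softMin hμ.second_moment he _
        have hi3 : Integrable (softMin y e fun k => g (y k) + e⁻¹ * (θ e • u e) k) μ :=
          integrable_softMin hμ.second_moment he _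
        -- The shrunk weights are the convex combination `(1 - θ) g* + θ a`. As `a` is at least as
        -- good as `g*`, concavity makes the combination at least as good too.
        have hcv := integral_mono ((hi1.const_mul (1 - θ e)).add (hi2.const_mul (θ e))) hi3
          fun x => by
            have := softMin_concave (y := y) he (g ∘ y) (a e) (hθ0 e) (hθ1 e) x
            refine this.trans_eq ?_
            congr 1
            funext k
            simp only [Function.comp, Pi.smul_apply, smul_eq_mul, hu]
            field_simp
            ring
        simp only [Pi.add_apply] at hcv
        rw [integral_add (hi1.const_mul _) (hi2.const_mul _), integral_const_mul,
          integral_const_mul] at hcv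
        nlinarith [hle e he, hθ0 e]
    rw [← hw0]
    refine hw.congr' ?_
    filter_upwards [(hη.comp hms.tendsto_atTop).eventually_ge_atTop 1] with m hm
    simp only [Function.comp] at hm ⊢
    rw [max_eq_right hm]
  refine hlim.congr' ?_
  -- Outside the unit ball the shrunk vector has norm exactly one. Once its norm is below one no
  -- shrinking has taken place, and it is `u η` itself.
  filter_upwards [(hlim.norm).eventually (gt_mem_nhds (by simp : ‖(0 : Fin n → ℝ)‖ < 1))] with η h
  have hle1 : ‖u η‖ ≤ 1 := by
    by_contra hgt
    rw [not_le] at hgt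
    rw [norm_smul, Real.norm_of_nonneg (hθ0 η)] at h
    simp only [θ, max_eq_right hgt.le] at h
    rw [inv_mul_cancel₀ (by linarith)] at h
    exact lt_irrefl _ h
  simp only [θ, max_eq_left hle1, inv_one, one_smul]

end Convergence

end SemiDiscreteOT

end

/-! ### Convergence of the potentials -/

open SemiDiscreteOT in
theorem theorem3 {d n : ℕ}
    (μ ν : Measure (EuclideanSpace ℝ (Fin d))) [IsProbabilityMeasure μ] [IsProbabilityMeasure ν]
    (p : EuclideanSpace ℝ (Fin d) → ℝ≥0) (y : Fin n → EuclideanSpace ℝ (Fin d))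
    (hν : SemiDiscreteOT.IsFinitelySupportedOn ν y)
    (hμ : SemiDiscreteOT.IsRegularSource μ p)
    -- the unregularized potentials `(f*, g*)` and the entropic potentials `(f_η, g_η)`
    (fs gs : EuclideanSpace ℝ (Fin d) → ℝ)
    (hs : SemiDiscreteOT.IsOptimalPotentials μ ν y fs gs)
    (f g : ℝ → EuclideanSpace ℝ (Fin d) → ℝ)
    (hη : ∀ η : ℝ, 0 < η → SemiDiscreteOT.IsEntropicPotentials μ ν y η (f η) (g η))
    -- either continuity along the hyperplanes, or a compactly supported continuous density
    (hreg : SemiDiscreteOT.IsContinuousAlongHyperplanes p y gs ∨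
      (IsCompact μ.support ∧ Continuous p)) :
    -- `η (g_η - g*) → 0` uniformly on the support of `ν`
    TendstoUniformlyOn (fun (η : ℝ) z => η * (g η z - gs z)) (fun _ => 0) atTop (Set.range y) ∧
    -- `η (f_η - f*) → 0` pointwise `μ`-a.e., for the continuous versions of the `f_η`
    ∃ fc : ℝ → EuclideanSpace ℝ (Fin d) → ℝ,
      (∀ η : ℝ, 0 < η → Continuous (fc η) ∧ fc η =ᵐ[μ] f η) ∧
      ∀ᵐ x ∂μ, Tendsto (fun η : ℝ => η * (fc η x - fs x)) atTop (𝓝 0) := by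
  have hn : NeZero n := hν.neZero
  have hac := hμ.absolutelyContinuous
  have h2 := hμ.second_moment
  have hy := hν.injective
  have hmass := hs.measure_powerCell hν h2 hac
  have hpos : ∀ i, μ (powerCell y gs i) ≠ 0 := fun i => by
    rw [hmass]; exact (hν.pos i).ne'
  have hreg' : IsContinuousAlongHyperplanes p y gs :=
    hreg.elim id fun h => .of_continuous hμ h.2 h.1 hy hpos
  have hlim : Tendsto (fun η k => η * ((g η ∘ y) k - gs (y k))) atTop (𝓝 (0 : Fin n → ℝ)) := by
    refine tendsto_weights hμ hy hpos hreg' (fun η h => ?_) fun η h =>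
      (hη η h).integral_softMin_le h h2 hs.feasible.integrable_right hs.normalized
    have h1 := (hη η h).normalized
    have h3 := hs.normalized
    rw [hν.integral_eq] at h1 h3
    simp only [measureReal_def, hmass, mul_sub, Finset.sum_sub_distrib, Function.comp] at h1 h3 ⊢
    rw [h1, h3, sub_zero]
  refine ⟨?_, fun η => softMin y η (g η ∘ y), fun η h => ⟨continuous_softMin _ _,
    ((hη η h).ae_eq_softMin h h2).symm⟩, ?_⟩
  · rw [Metric.tendstoUniformlyOn_iff]
    intro ε hε
    filter_upwards [(tendsto_pi_nhds.1 hlim |> fun h => eventually_all.2 fun k =>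
      Metric.tendsto_nhds.1 (h k) ε hε)] with η h
    rintro _ ⟨k, rfl⟩
    rw [dist_comm]
    exact h k
  · filter_upwards [hs.ae_eq_powerMin hν h2, ae_slack_ne (g := gs) hy hac] with x hx hne
    have hxi : x ∈ ⋃ i, powerCell y gs i := by rw [iUnion_powerCell]; trivial
    obtain ⟨i, hi⟩ := mem_iUnion.1 hxi
    -- Away from the interfaces every slack with `k ≠ i` is strictly positive, so only the term `k =
    -- i` survives. The rescaled error of `f_η` is minus the logarithm of this sum, which tends to
    -- `-log 1 = 0`.
    have hterm : ∀ k, Tendsto (fun η : ℝ => Real.exp (-(η * slack y gs i k x)) *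
        Real.exp (η * ((g η ∘ y) k - gs (y k)))) atTop (𝓝 (if k = i then 1 else 0)) := by
      intro k
      have h1 : Tendsto (fun η : ℝ => Real.exp (η * ((g η ∘ y) k - gs (y k)))) atTop (𝓝 1) := by
        have h3 := (Real.continuous_exp.tendsto _).comp (tendsto_pi_nhds.1 hlim k)
        rw [Pi.zero_apply, Real.exp_zero] at h3
        exact h3
      split_ifs with hk
      · simpa [hk, slack_self] using (hk ▸ h1)
      · have hpos := lt_of_le_of_ne (mem_powerCell_iff.1 hi k) (hne i k (Ne.symm hk)).symm
        have h3 : Tendsto (fun η : ℝ => Real.exp (-(η * slack y gs i k x))) atTop (𝓝 0) :=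
          Real.tendsto_exp_neg_atTop_nhds_zero.comp (tendsto_id.atTop_mul_const hpos)
        simpa using h3.mul h1
    have hsum := tendsto_finsetSum Finset.univ fun k _ => hterm k
    rw [Finset.sum_ite_eq' Finset.univ i, if_pos (Finset.mem_univ i)] at hsum
    have hlog := ((Real.continuousAt_log one_ne_zero).tendsto.comp hsum).neg
    rw [Real.log_one, neg_zero] at hlog
    refine hlog.congr' ?_
    filter_upwards [eventually_gt_atTop 0] with η h
    have e1 : (g η ∘ y) = fun k => gs (y k) + η⁻¹ * (η * ((g η ∘ y) k - gs (y k))) := by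
      funext k
      field_simp
      ring
    rw [hx, powerMin_eq hi, softMin]
    conv_rhs => rw [e1, log_gibbsSum_eq h _ i x]
    simp only [Function.comp]
    field_simp
    ring
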